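/- Let $a>b>0$, $p^2=a^2+b^2$, $r^2=a^2-b^2$. The phase space is $$\mathcal P=\{(\alpha,\beta,\omega)\in(\mathbb R^3)^3:\ |\alpha|^2=a^2,\ |\beta|^2=b^2,\ \alpha\cdot\beta=0\}.$$ Put $x_{1,2}=(\alpha_1-\beta_2)\pm i(\alpha_2+\beta_1)$, $y_{1,2}=(\alpha_1+\beta_2)\pm i(\alpha_2-\beta_1)$, $z_{1,2}=\alpha_3\pm i\beta_3$, $w_{1,2}=\omega_1\pm i\omega_2$, $w_3=\omega_3$. Let $\mathfrak O_0\subset\mathcal P$ be the set of points with $w_1\neq0$ satisfying $$\frac{w_2x_1+w_1y_2+w_3z_1}{w_1}-\frac{w_1x_2+w_2y_1+w_3z_2}{w_2}=0,$$ $$(w_2z_1+w_1z_2)w_3^2+\Bigl[\frac{w_2z_1^2}{w_1}+\frac{w_1z_2^2}{w_2}+w_1w_2(y_1+y_2)+x_1w_2^2+x_2w_1^2\Bigr]w_3+\frac{w_2^2x_1z_1}{w_1}+\frac{w_1^2x_2z_2}{w_2}+x_1z_2w_2+x_2z_1w_1+(w_1z_2-w_2z_1)(y_1-y_2)=0,$$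 and let $$S=-\frac14\Bigl(\frac{y_2w_1+x_1w_2+z_1w_3}{w_1}+\frac{x_2w_1+y_1w_2+z_2w_3}{w_2}\Bigr),$$ $$\mathrm T=\frac12\bigl[w_1(x_2w_1+y_1w_2+z_2w_3)+w_2(y_2w_1+x_1w_2+z_1w_3)\bigr]+x_1x_2+z_1z_2 .$$ Since $S$ has the indeterminate form $0/0$ at $w_1=w_2=0$, the third critical subsystem $\mathfrak O$ is completed by its limit points: $\mathfrak O$ is the closure in $\mathcal P\times\mathbb R$ of the graph of $S$ over $\mathfrak O_0$, and the integral map is $S\times\mathrm T:\mathfrak O\to\mathbb R^2$, $(x,s)\mapsto(s,\mathrm T(x))$ (over $\mathfrak O_0$ this is the original map). Let $\sigma=\tau^2-2p^2\tau+r^4$. The separating set is the set of $(s,\tau)\in\mathbb R^2$ for which the polynomial in $t$ $$\bigl(t^2-4s^2\tau-\sigma\bigr)\bigl(t^2-\sigma\bigr)\bigl((t+\tau)^2-r^4\bigr)$$ (the maximal polynomial of the separated equations of motion up to the factor $1/(s\tau)$) has a multiple complex root. The bifurcation diagram of $S\times\mathrm T$ is the part of the separating set that lies in the image $(S\times\mathrm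 T)(\mathfrak O)$. A point of $\mathfrak O$ is called regular if near it $\mathfrak O$ is a smooth four-dimensional submanifold of $\mathbb R^9\times\mathbb R$ on which $S\times\mathrm T$ is a submersion at that point; the other points are critical. Let $$\theta(\tau)=\frac12\sqrt{2p^2-\frac{\tau^2+r^4}{\tau}} .$$ **Theorem.** The bifurcation diagram of $S\times\mathrm T$ on $\mathfrak O$ is the union of the following sets: - $\tau=0$, $s\in(0,+\infty)$; - $\tau=(a-b)^2$, $s\in[-a,-b]\cup(0,+\infty)$; - $\tau=(a+b)^2$, $s\in[-a,0)\cup(b,+\infty)$; - $s=-a$, $\tau\in[(a-b)^2,+\infty)$; - $s=-b$, $\tau\in[(a-b)^2,+\infty)$; - $s=-\theta(\tau)$, $\tau\in(r^2,(a+b)^2)$; - $s=\theta(\tau)$, $\tau\in(-r^2,0)\cup((a-b)^2,r^2)$; - $s=b$, $\tau\in(-\infty,(a+b)^2]$; - $s=a$, $\tau\in(-\infty,(a+b)^2]$. Moreover, the set of values of $S\times\mathrm T$ at its critical points is this diagram with the points $(s,0)$, $s>0$, $s\ne a$, $s\neq b$, removed (on the ray $\tau=0$ only the separated equations degenerate).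 -/

import Mathlib

open scoped ContDiff

namespace KowalevskiTop

noncomputable section

/-- Triples of vectors `(α, β, ω)` in `ℝ³`: the two force fields and the angular velocity. -/
abbrev State : Type := (Fin 3 → ℝ) × (Fin 3 → ℝ) × (Fin 3 → ℝ)

/-- `α_{i+1}` -/
def al (p : State) (i : Fin 3) : ℝ := p.1 i

/-- `β_{i+1}` -/
def be (p : State) (i : Fin 3) : ℝ := p.2.1 i

/-- `ω_{i+1}` -/
def om (p : State) (i : Fin 3) : ℝ := p.2.2 i

/-- The six-dimensional phase space: `α² = a²`, `β² = b²`, `α · β = 0`, with `ω` arbitrary. -/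
def phaseSpace (a b : ℝ) : Set State :=
  {p | ∑ i, al p i ^ 2 = a ^ 2 ∧ ∑ i, be p i ^ 2 = b ^ 2 ∧ ∑ i, al p i * be p i = 0}

/-! The complex change of variables. -/

def x₁ (p : State) : ℂ := ((al p 0 - be p 1 : ℝ) : ℂ) + Complex.I * ((al p 1 + be p 0 : ℝ) : ℂ)
def x₂ (p : State) : ℂ := ((al p 0 - be p 1 : ℝ) : ℂ) - Complex.I * ((al p 1 + be p 0 : ℝ) : ℂ)
def y₁ (p : State) : ℂ := ((al p 0 + be p 1 : ℝ) : ℂ) + Complex.I * ((al p 1 - be p 0 : ℝ) : ℂ)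
def y₂ (p : State) : ℂ := ((al p 0 + be p 1 : ℝ) : ℂ) - Complex.I * ((al p 1 - be p 0 : ℝ) : ℂ)
def z₁ (p : State) : ℂ := (al p 2 : ℂ) + Complex.I * (be p 2 : ℂ)
def z₂ (p : State) : ℂ := (al p 2 : ℂ) - Complex.I * (be p 2 : ℂ)
def w₁ (p : State) : ℂ := (om p 0 : ℂ) + Complex.I * (om p 1 : ℂ)
def w₂ (p : State) : ℂ := (om p 0 : ℂ) - Complex.I * (om p 1 : ℂ)
def w₃ (p : State) : ℂ := (om p 2 : ℂ)

/-- Left-hand side of the first equation of the third critical subsystem. -/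
def eqOne (p : State) : ℂ :=
  (w₂ p * x₁ p + w₁ p * y₂ p + w₃ p * z₁ p) / w₁ p
    - (w₁ p * x₂ p + w₂ p * y₁ p + w₃ p * z₂ p) / w₂ p

/-- Left-hand side of the second equation of the third critical subsystem. -/
def eqTwo (p : State) : ℂ :=
  (w₂ p * z₁ p + w₁ p * z₂ p) * w₃ p ^ 2
    + (w₂ p * z₁ p ^ 2 / w₁ p + w₁ p * z₂ p ^ 2 / w₂ p + w₁ p * w₂ p * (y₁ p + y₂ p)
        + x₁ p * w₂ p ^ 2 + x₂ p * w₁ p ^ 2) * w₃ p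
    + w₂ p ^ 2 * x₁ p * z₁ p / w₁ p + w₁ p ^ 2 * x₂ p * z₂ p / w₂ p
    + x₁ p * z₂ p * w₂ p + x₂ p * z₁ p * w₁ p
    + (w₁ p * z₂ p - w₂ p * z₁ p) * (y₁ p - y₂ p)

/-- The third critical subsystem, at the points where its equations are defined
(`w₁` and `w₂` are complex conjugate, so `w₁ ≠ 0` says that neither denominator vanishes). -/
def subsystemO (a b : ℝ) : Set State :=
  {p | p ∈ phaseSpace a b ∧ w₁ p ≠ 0 ∧ eqOne p = 0 ∧ eqTwo p = 0}

/-- The integral `S`. The two summands are complex conjugate, so the bracket is real and `.re`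
only changes the type. -/
def integralS (p : State) : ℝ :=
  (-(1 / 4) * ((y₂ p * w₁ p + x₁ p * w₂ p + z₁ p * w₃ p) / w₁ p
    + (x₂ p * w₁ p + y₁ p * w₂ p + z₂ p * w₃ p) / w₂ p)).re

/-- The integral `T`; again the complex expression is real. -/
def integralT (p : State) : ℝ :=
  ((1 / 2) * (w₁ p * (x₂ p * w₁ p + y₁ p * w₂ p + z₂ p * w₃ p)
    + w₂ p * (y₂ p * w₁ p + x₁ p * w₂ p + z₁ p * w₃ p)) + x₁ p * x₂ p + z₁ p * z₂ p).re

/-- The third critical subsystem completed by its limit points at `w₁ = w₂ = 0`, where `S` has the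
indeterminate form `0/0`: the closure of the graph of `S`. Its points are pairs
`(state, value of S)`; over the states with `w₁ ≠ 0` it is the graph of `S` itself. -/
def completedO (a b : ℝ) : Set (State × ℝ) :=
  closure {q | q.1 ∈ subsystemO a b ∧ q.2 = integralS q.1}

/-- The integral map `S × T` (on the completed subsystem, `S` is the last coordinate). -/
def integralMap (q : State × ℝ) : ℝ × ℝ := (q.2, integralT q.1)

/-- The set of admissible values `(s, τ)`: those with nonempty integral manifold. -/
def admissibleSet (a b : ℝ) : Set (ℝ × ℝ) := integralMap '' completedO a b

/-- `σ = τ² - 2p²τ + r⁴`, with `p² = a² + b²` and `r² = a² - b²`. -/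
def sigma (a b τ : ℝ) : ℝ := τ ^ 2 - 2 * (a ^ 2 + b ^ 2) * τ + (a ^ 2 - b ^ 2) ^ 2

open Polynomial in
/-- The maximal polynomial of the separated equations up to the factor `1 / (sτ)`:
`(t² - 4s²χ²)(t² - σ)((t + τ)² - r⁴)`, where `4s²χ² = 4s²τ + σ`. -/
def maximalPolynomial (a b s τ : ℝ) : ℝ[X] :=
  (X ^ 2 - C (4 * s ^ 2 * τ + sigma a b τ)) * (X ^ 2 - C (sigma a b τ))
    * ((X + C τ) ^ 2 - C ((a ^ 2 - b ^ 2) ^ 2))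

/-- The separating set: the parameters for which the maximal polynomial has a multiple
(possibly complex) root. -/
def separatingSet (a b : ℝ) : Set (ℝ × ℝ) :=
  {f | ¬ (maximalPolynomial a b f.1 f.2).Separable}

/-- The bifurcation diagram: the admissible part of the separating set. -/
def bifurcationDiagram (a b : ℝ) : Set (ℝ × ℝ) := admissibleSet a b ∩ separatingSet a b

/-- `q` is a regular point of `F` on `M ⊆ ℝ⁹ × ℝ`: near `q` the set `M` is a smooth
four-dimensional submanifold (the zero set of a smooth `g` with values in `ℝ⁶` and surjective
derivative at `q`), and the restriction of `F` to it is a submersion at `q`; both rank conditions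
together say that `(g, F)` has surjective derivative at `q`. -/
def IsRegularPoint (M : Set (State × ℝ)) (F : State × ℝ → ℝ × ℝ) (q : State × ℝ) : Prop :=
  ∃ W : Set (State × ℝ), IsOpen W ∧ q ∈ W ∧ ∃ g : State × ℝ → (Fin 6 → ℝ),
    ContDiffOn ℝ ∞ g W ∧ (∀ u ∈ W, u ∈ M ↔ g u = 0) ∧
      Function.Surjective (fderiv ℝ (fun u => (g u, F u)) q)

/-- The values of the integral map at the points of the completed subsystem where it is not
regular. -/
def criticalValues (a b : ℝ) : Set (ℝ × ℝ) :=
  integralMap '' {q | q ∈ completedO a b ∧ ¬ IsRegularPoint (completedO a b) integralMap q}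

/-- `θ(τ) = (1/2) √(2p² - (τ² + r⁴)/τ)`. -/
def theta (a b τ : ℝ) : ℝ :=
  (1 / 2) * Real.sqrt (2 * (a ^ 2 + b ^ 2) - (τ ^ 2 + (a ^ 2 - b ^ 2) ^ 2) / τ)

end

end KowalevskiTop

namespace KowalevskiTop

noncomputable section

/-! Put A = α + s e₁, B = β + s e₂ and M = (2ω₁, 2ω₂, ω₃). Where w₁ ≠ 0, the two equations of the
subsystem together with s = S say exactly that A·M = B·M = 0 and A × B = (sω₃/2)M. These equations
are polynomial, and each of their solutions with w₁ = 0 is a limit of solutions with w₁ ≠ 0; hence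
they cut out the completed subsystem (`completedO_eq`).

On this variety X = x₁ and Y = y₁ + 2s satisfy |Y|² − |X|² = 2sω₃² and the hermitian relation τ|Y|²
− 2r² Re(X̄Y) + (2p² − 4s² − τ)|X|² = 0 (`TiltedEquations.quadratic_relation`), whose determinant is
−(4s²τ + σ). Together with |(α × β)₃| ≤ ab they bound the image (`bounds_of_pos`, `bounds_of_neg`),
and the bounds cut the curves of the separating set (`mem_separatingSet_iff`) down to the listed
arcs.

A point is shown to be critical by a function that vanishes on the variety and whose differential
there is a nontrivial combination of ds and dT (`not_isRegularPoint`). For s = ±a, ±b it comes from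
the third component of A × B − (sω₃/2)M at a point where A or B vanishes; on the other arcs it comes
from the hermitian relation. Conversely, off the curves σ = 0, 4s²τ + σ = 0, s² = a², s² = b², a
Lagrange multiplier computation (`multiplier_of_ne`, `multiplier_of_eq`) gives full rank. The line τ
= 0 is not one of these curves, and on it σ = 4s²τ + σ = r⁴ ≠ 0; so its only critical values are
those with s = a or s = b. -/

/-! ### The subsystem as a polynomial variety. -/

/-- `(α + s e₁) · M` for the angular momentum `M = (2ω₁, 2ω₂, ω₃)`. -/
def dotA (u : State × ℝ) : ℝ :=
  2 * (u.1.1 0 + u.2) * u.1.2.2 0 + 2 * u.1.1 1 * u.1.2.2 1 + u.1.1 2 * u.1.2.2 2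

/-- `(β + s e₂) · M` for the angular momentum `M = (2ω₁, 2ω₂, ω₃)`. -/
def dotB (u : State × ℝ) : ℝ :=
  2 * u.1.2.1 0 * u.1.2.2 0 + 2 * (u.1.2.1 1 + u.2) * u.1.2.2 1 + u.1.2.1 2 * u.1.2.2 2

/-- `(α + s e₁) × (β + s e₂) - (s ω₃ / 2) M` for the angular momentum `M = (2ω₁, 2ω₂, ω₃)`. -/
def defect (u : State × ℝ) : Fin 3 → ℝ :=
  ![u.1.1 1 * u.1.2.1 2 - u.1.1 2 * (u.1.2.1 1 + u.2) - u.2 * u.1.2.2 2 * u.1.2.2 0,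
    u.1.1 2 * u.1.2.1 0 - (u.1.1 0 + u.2) * u.1.2.1 2 - u.2 * u.1.2.2 2 * u.1.2.2 1,
    (u.1.1 0 + u.2) * (u.1.2.1 1 + u.2) - u.1.1 1 * u.1.2.1 0 - u.2 / 2 * u.1.2.2 2 ^ 2]

/-- The algebraic variety which turns out to be the completed third critical subsystem. -/
def algebraicO (a b : ℝ) : Set (State × ℝ) :=
  {u | u.1 ∈ phaseSpace a b ∧ dotA u = 0 ∧ dotB u = 0 ∧ defect u = 0}

lemma mem_phaseSpace_iff {a b : ℝ} {p : State} : p ∈ phaseSpace a b ↔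
    p.1 0 ^ 2 + p.1 1 ^ 2 + p.1 2 ^ 2 = a ^ 2 ∧
    p.2.1 0 ^ 2 + p.2.1 1 ^ 2 + p.2.1 2 ^ 2 = b ^ 2 ∧
    p.1 0 * p.2.1 0 + p.1 1 * p.2.1 1 + p.1 2 * p.2.1 2 = 0 := by
  simp [phaseSpace, Fin.sum_univ_three, al, be]

lemma mem_algebraicO_iff {a b : ℝ} {α β w : Fin 3 → ℝ} {s : ℝ} :
    ((α, β, w), s) ∈ algebraicO a b ↔
    (α 0 ^ 2 + α 1 ^ 2 + α 2 ^ 2 = a ^ 2 ∧ β 0 ^ 2 + β 1 ^ 2 + β 2 ^ 2 = b ^ 2 ∧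
      α 0 * β 0 + α 1 * β 1 + α 2 * β 2 = 0) ∧
    2 * (α 0 + s) * w 0 + 2 * α 1 * w 1 + α 2 * w 2 = 0 ∧
    2 * β 0 * w 0 + 2 * (β 1 + s) * w 1 + β 2 * w 2 = 0 ∧
    α 1 * β 2 - α 2 * (β 1 + s) = s * w 2 * w 0 ∧
    α 2 * β 0 - (α 0 + s) * β 2 = s * w 2 * w 1 ∧
    (α 0 + s) * (β 1 + s) - α 1 * β 0 = s / 2 * w 2 ^ 2 := by
  have h : ∀ v : Fin 3 → ℝ, v = 0 ↔ v 0 = 0 ∧ v 1 = 0 ∧ v 2 = 0 := by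
    intro v
    simp [funext_iff, Fin.forall_fin_succ]
  simp only [algebraicO, Set.mem_ofPred_eq, mem_phaseSpace_iff, dotA, dotB, h, defect]
  simp [sub_eq_zero]

lemma integralT_eq (p : State) : integralT p =
    (p.1 0 ^ 2 + p.1 1 ^ 2 + p.1 2 ^ 2) + (p.2.1 0 ^ 2 + p.2.1 1 ^ 2 + p.2.1 2 ^ 2)
      - 2 * (p.1 0 * p.2.1 1 - p.1 1 * p.2.1 0)
      + p.2.2 0 * (2 * p.1 0 * p.2.2 0 + 2 * p.1 1 * p.2.2 1 + p.1 2 * p.2.2 2)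
      + p.2.2 1 * (2 * p.2.1 0 * p.2.2 0 + 2 * p.2.1 1 * p.2.2 1 + p.2.1 2 * p.2.2 2) := by
  simp [integralT, x₁, x₂, y₁, y₂, z₁, z₂, w₁, w₂, w₃, al, be, om]
  ring

lemma integralT_of_mem {a b : ℝ} {u : State × ℝ} (hu : u ∈ algebraicO a b) :
    integralT u.1 = a ^ 2 + b ^ 2 - 2 * (u.1.1 0 * u.1.2.1 1 - u.1.1 1 * u.1.2.1 0)
      - 2 * u.2 * (u.1.2.2 0 ^ 2 + u.1.2.2 1 ^ 2) := by
  obtain ⟨⟨α, β, w⟩, s⟩ := u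
  rw [mem_algebraicO_iff] at hu
  obtain ⟨⟨h1, h2, h3⟩, h4, h5, -⟩ := hu
  rw [integralT_eq]
  linear_combination h1 + h2 + w 0 * h4 + w 1 * h5

lemma isClosed_algebraicO (a b : ℝ) : IsClosed (algebraicO a b) := by
  have h : algebraicO a b = {u : State × ℝ | (u.1.1 0 ^ 2 + u.1.1 1 ^ 2 + u.1.1 2 ^ 2 = a ^ 2 ∧
      u.1.2.1 0 ^ 2 + u.1.2.1 1 ^ 2 + u.1.2.1 2 ^ 2 = b ^ 2 ∧
      u.1.1 0 * u.1.2.1 0 + u.1.1 1 * u.1.2.1 1 + u.1.1 2 * u.1.2.1 2 = 0) ∧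
      dotA u = 0 ∧ dotB u = 0 ∧ defect u = 0} := by
    ext u
    rw [algebraicO, Set.mem_ofPred_eq, mem_phaseSpace_iff]
    rfl
  rw [h]
  simp only [Set.ofPred_and]
  unfold dotA dotB defect
  refine .inter (.inter ?_ (.inter ?_ ?_)) (.inter ?_ (.inter ?_ ?_)) <;>
  exact isClosed_eq (by fun_prop) (by fun_prop)

lemma w₁_ne_zero_iff {p : State} : w₁ p ≠ 0 ↔ 0 < p.2.2 0 ^ 2 + p.2.2 1 ^ 2 := by
  have : w₁ p = 0 ↔ p.2.2 0 = 0 ∧ p.2.2 1 = 0 := by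
    simp [w₁, om, Complex.ext_iff]
  rw [Ne, this]
  constructor
  · intro h
    by_contra hn
    exact h ⟨by nlinarith [sq_nonneg (p.2.2 0), sq_nonneg (p.2.2 1)],
      by nlinarith [sq_nonneg (p.2.2 0), sq_nonneg (p.2.2 1)]⟩
  · rintro h ⟨h0, h1⟩
    simp [h0, h1] at h

/-- The numerator of the first summand of `S`, with `w₁` subtracted `-2s` times. -/
lemma numerator_eq (p : State) (s : ℝ) :
    w₂ p * x₁ p + w₁ p * y₂ p + w₃ p * z₁ p + 2 * s * w₁ p =
      (dotA (p, s) : ℂ) + Complex.I * (dotB (p, s) : ℂ) := by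
  apply Complex.ext <;>
  simp [x₁, y₂, z₁, w₁, w₂, w₃, al, be, om, dotA, dotB] <;> ring

lemma numerator_conj_eq (p : State) (s : ℝ) :
    w₁ p * x₂ p + w₂ p * y₁ p + w₃ p * z₂ p + 2 * s * w₂ p =
      (dotA (p, s) : ℂ) - Complex.I * (dotB (p, s) : ℂ) := by
  apply Complex.ext <;>
  simp [x₂, y₁, z₂, w₁, w₂, w₃, al, be, om, dotA, dotB] <;> ring

lemma w₂_eq_conj (p : State) : w₂ p = (starRingEnd ℂ) (w₁ p) := by
  simp [w₁, w₂, Complex.ext_iff]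

/-- The orthogonality relations express each fraction through y₂ + 2s or y₁ + 2s, so all
denominators disappear. What remains is the horizontal part of ω contracted with A × B − (sω₃/2)M.
-/
lemma eqTwo_eq {p : State} {s : ℝ} (hw : w₁ p ≠ 0) (hA : dotA (p, s) = 0)
    (hB : dotB (p, s) = 0) : eqTwo p = ((4 * (p.2.2 0 * (defect (p, s) 0)
      + p.2.2 1 * (defect (p, s) 1)) : ℝ) : ℂ) := by
  have hw2 : w₂ p ≠ 0 := by rw [w₂_eq_conj]; simpa using hw
  have h1 := numerator_eq p s
  have h2 := numerator_conj_eq p s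
  simp only [hA, hB, Complex.ofReal_zero, mul_zero, add_zero, sub_zero] at h1 h2
  have e1 : (w₂ p * x₁ p + w₃ p * z₁ p) / w₁ p = - y₂ p - 2 * s := by
    field_simp
    linear_combination h1
  have e2 : (w₁ p * x₂ p + w₃ p * z₂ p) / w₂ p = - y₁ p - 2 * s := by
    field_simp
    linear_combination h2
  have h3 : eqTwo p = -4 * s * w₁ p * w₂ p * w₃ p
      + w₁ p * (x₂ p * z₁ p - z₂ p * (y₂ p + 2 * s))
      + w₂ p * (x₁ p * z₂ p - z₁ p * (y₁ p + 2 * s)) := by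
    have : eqTwo p = (w₂ p * z₁ p + w₁ p * z₂ p) * w₃ p ^ 2
        + (w₁ p * w₂ p * (y₁ p + y₂ p) + x₁ p * w₂ p ^ 2 + x₂ p * w₁ p ^ 2) * w₃ p
        + w₂ p * z₁ p * ((w₂ p * x₁ p + w₃ p * z₁ p) / w₁ p)
        + w₁ p * z₂ p * ((w₁ p * x₂ p + w₃ p * z₂ p) / w₂ p)
        + x₁ p * z₂ p * w₂ p + x₂ p * z₁ p * w₁ p
        + (w₁ p * z₂ p - w₂ p * z₁ p) * (y₁ p - y₂ p) := by
      unfold eqTwo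
      ring
    rw [this, e1, e2]
    linear_combination w₂ p * w₃ p * h1 + w₁ p * w₃ p * h2
  rw [h3]
  apply Complex.ext <;>
  simp [x₁, x₂, y₁, y₂, z₁, z₂, w₁, w₂, w₃, al, be, om, defect, -Complex.ofReal_add,
    -Complex.ofReal_sub, -Complex.ofReal_mul] <;> ring

lemma integralS_eq_of_dot {p : State} {s : ℝ} (hw : w₁ p ≠ 0) (hA : dotA (p, s) = 0)
    (hB : dotB (p, s) = 0) : eqOne p = 0 ∧ integralS p = s := by
  have hw2 : w₂ p ≠ 0 := by rw [w₂_eq_conj]; simpa using hw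
  have h1 := numerator_eq p s
  have h2 := numerator_conj_eq p s
  simp only [hA, hB, Complex.ofReal_zero, mul_zero, add_zero, sub_zero] at h1 h2
  have e1 : (w₂ p * x₁ p + w₁ p * y₂ p + w₃ p * z₁ p) / w₁ p = - 2 * s := by
    field_simp
    linear_combination h1
  have e2 : (w₁ p * x₂ p + w₂ p * y₁ p + w₃ p * z₂ p) / w₂ p = - 2 * s := by
    field_simp
    linear_combination h2
  refine ⟨by rw [eqOne, e1, e2, sub_self], ?_⟩
  have e1' : (y₂ p * w₁ p + x₁ p * w₂ p + z₁ p * w₃ p) / w₁ p = - 2 * s := by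
    rw [← e1]; ring
  have e2' : (x₂ p * w₁ p + y₁ p * w₂ p + z₂ p * w₃ p) / w₂ p = - 2 * s := by
    rw [← e2]; ring
  rw [integralS, e1', e2']
  have : (-(1 / 4) * (-2 * (s : ℂ) + -2 * (s : ℂ))) = (s : ℂ) := by ring
  rw [this, Complex.ofReal_re]

/-- The two fractions are complex conjugate, so their equality makes the first one real, equal to
−2S; clearing w₁ gives one complex equation, that is, two real ones. -/
lemma dot_eq_zero_of_eqOne {p : State} (hw : w₁ p ≠ 0) (h : eqOne p = 0) :
    dotA (p, integralS p) = 0 ∧ dotB (p, integralS p) = 0 := by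
  set k := (w₂ p * x₁ p + w₁ p * y₂ p + w₃ p * z₁ p) / w₁ p with hk
  have hc : (w₁ p * x₂ p + w₂ p * y₁ p + w₃ p * z₂ p) / w₂ p = (starRingEnd ℂ) k := by
    rw [hk]
    simp only [map_div₀, map_add, map_mul]
    congr 1 <;> simp [x₁, x₂, y₁, y₂, z₁, z₂, w₁, w₂, w₃] <;> ring
  rw [eqOne, ← hk, hc] at h
  have hS : integralS p = -(1 / 2) * k.re := by
    have e1' : (y₂ p * w₁ p + x₁ p * w₂ p + z₁ p * w₃ p) / w₁ p = k := by
      rw [hk]; ring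
    have e2' : (x₂ p * w₁ p + y₁ p * w₂ p + z₂ p * w₃ p) / w₂ p = (starRingEnd ℂ) k := by
      rw [← hc]; ring
    rw [integralS, e1', e2', Complex.add_conj]
    simp
    ring
  have hkr : k = (k.re : ℂ) := by
    have := sub_eq_zero.1 h
    exact (Complex.conj_eq_iff_re.1 this.symm).symm
  have h0 : (dotA (p, integralS p) : ℂ) + Complex.I * (dotB (p, integralS p) : ℂ) = 0 := by
    rw [← numerator_eq, hS]
    have : w₂ p * x₁ p + w₁ p * y₂ p + w₃ p * z₁ p = k * w₁ p := by
      rw [hk]; field_simp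
    rw [this, hkr]
    push_cast
    simp only [Complex.ofReal_re]
    ring
  have h1 := congrArg Complex.re h0
  have h2 := congrArg Complex.im h0
  simp at h1 h2
  exact ⟨h1, h2⟩

lemma graph_eq (a b : ℝ) :
    {q : State × ℝ | q.1 ∈ subsystemO a b ∧ q.2 = integralS q.1} =
      {q | q ∈ algebraicO a b ∧ w₁ q.1 ≠ 0} := by
  ext ⟨p, s⟩
  simp only [subsystemO, Set.mem_ofPred_eq]
  constructor
  · rintro ⟨⟨hp, hw, h1, h2⟩, rfl⟩
    obtain ⟨hA, hB⟩ := dot_eq_zero_of_eqOne hw h1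
    refine ⟨⟨hp, hA, hB, ?_⟩, hw⟩
    rw [eqTwo_eq hw hA hB, Complex.ofReal_eq_zero] at h2
    have hm := (w₁_ne_zero_iff.1 hw).ne'
    generalize integralS p = s at *
    obtain ⟨α, β, w⟩ := p
    simp only [dotA, dotB] at hA hB hm
    simp only [defect, Matrix.cons_val_zero, Matrix.cons_val_one] at h2 ⊢
    -- Since A and B are orthogonal to M ≠ 0, the vector A × B, hence also the defect, is parallel
    -- to M. Its contraction with (ω₁, ω₂) vanishes while ω₁² + ω₂² ≠ 0, so the factor of
    -- proportionality is zero.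
    have e0 : α 1 * β 2 - α 2 * (β 1 + s) - s * w 2 * w 0 = 0 := by
      refine (mul_eq_zero.1 ?_).resolve_left hm
      linear_combination (w 0 / 4) * h2 - (w 1 / 2) * (α 2 * hB - β 2 * hA)
    have e1 : α 2 * β 0 - (α 0 + s) * β 2 - s * w 2 * w 1 = 0 := by
      refine (mul_eq_zero.1 ?_).resolve_left hm
      linear_combination (w 1 / 4) * h2 + (w 0 / 2) * (α 2 * hB - β 2 * hA)
    have e2 : (α 0 + s) * (β 1 + s) - α 1 * β 0 - s / 2 * w 2 ^ 2 = 0 := by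
      refine (mul_eq_zero.1 ?_).resolve_left hm
      linear_combination (w 2 / 8) * h2 + (w 0 / 2) * ((β 1 + s) * hA - α 1 * hB)
        + (w 1 / 2) * ((α 0 + s) * hB - β 0 * hA)
    rw [e0, e1, e2]
    ext i
    fin_cases i <;> rfl
  · rintro ⟨⟨hp, hA, hB, hd⟩, hw⟩
    obtain ⟨h1, h2⟩ := integralS_eq_of_dot hw hA hB
    refine ⟨⟨hp, hw, h1, ?_⟩, h2.symm⟩
    rw [eqTwo_eq hw hA hB, hd]
    simp

/-! ### Points with ω₁ = ω₂ = 0 as limits. -/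

open Filter Topology

/-- For s = 0 the equations give α × β = 0, whereas |α × β| = ab by Lagrange's identity. -/
lemma ne_zero_of_mem {a b : ℝ} (hb : 0 < b) (hab : b < a) {u : State × ℝ}
    (hu : u ∈ algebraicO a b) : u.2 ≠ 0 := by
  obtain ⟨⟨α, β, w⟩, s⟩ := u
  rw [mem_algebraicO_iff] at hu
  obtain ⟨⟨h1, h2, h3⟩, h4, h5, h6, h7, h8⟩ := hu
  simp only
  rintro rfl
  simp only [add_zero, zero_mul, zero_div] at *
  have : a ^ 2 * b ^ 2 = 0 := by
    linear_combination -h1 * b ^ 2 - (α 0 ^ 2 + α 1 ^ 2 + α 2 ^ 2) * h2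
      + (α 0 * β 0 + α 1 * β 1 + α 2 * β 2) * h3 + (α 1 * β 2 - α 2 * β 1) * h6
      + (α 2 * β 0 - α 0 * β 2) * h7 + (α 0 * β 1 - α 1 * β 0) * h8
  have : 0 < a ^ 2 * b ^ 2 := by
    have : 0 < a := hb.trans hab
    positivity
  linarith

lemma mem_closure_of_curve {a b : ℝ} {u : State × ℝ} (c : ℝ → State × ℝ)
    (hc : ContinuousAt c 0) (h0 : c 0 = u)
    (h : ∀ᶠ t in 𝓝[≠] (0 : ℝ), c t ∈ algebraicO a b ∧ w₁ (c t).1 ≠ 0) :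
    u ∈ completedO a b := by
  rw [completedO, graph_eq]
  refine mem_closure_of_tendsto (f := c) (b := 𝓝[≠] (0 : ℝ)) ?_ h
  rw [← h0]
  exact hc.tendsto.mono_left nhdsWithin_le_nhds

lemma exists_horizontal_orthogonal {A B : Fin 3 → ℝ}
    (h : A 0 * B 1 - A 1 * B 0 = 0) :
    ∃ m n : ℝ, 0 < m ^ 2 + n ^ 2 ∧ A 0 * m + A 1 * n = 0 ∧ B 0 * m + B 1 * n = 0 := by
  by_cases hA : A 0 = 0 ∧ A 1 = 0
  · by_cases hB : B 0 = 0 ∧ B 1 = 0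
    · exact ⟨1, 0, by norm_num, by simp [hA], by simp [hB]⟩
    · refine ⟨-B 1, B 0, ?_, by rw [hA.1, hA.2]; ring, by ring⟩
      rw [neg_sq]
      rcases not_and_or.1 hB with h | h <;> positivity
  · refine ⟨-A 1, A 0, ?_, by ring, by linear_combination h⟩
    rw [neg_sq]
    rcases not_and_or.1 hA with h | h <;> positivity

/-- With ω = 0 the vectors A and B are parallel, so some horizontal vector is orthogonal to both.
Moving ω along it keeps ω₃ = 0 and leaves A × B = 0 untouched. -/
lemma mem_completedO_of_horizontal {a b : ℝ} {α β w : Fin 3 → ℝ} {s : ℝ}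
    (hu : ((α, β, w), s) ∈ algebraicO a b) (h0 : w 0 = 0) (h1 : w 1 = 0) (h2 : w 2 = 0) :
    ((α, β, w), s) ∈ completedO a b := by
  rw [mem_algebraicO_iff] at hu
  obtain ⟨hp, h4, h5, h6, h7, h8⟩ := hu
  simp only [h2, mul_zero, zero_mul, ne_eq, OfNat.ofNat_ne_zero, not_false_eq_true,
    zero_pow] at h6 h7 h8
  obtain ⟨m, n, hmn, hA, hB⟩ := exists_horizontal_orthogonal
    (A := ![α 0 + s, α 1, α 2]) (B := ![β 0, β 1 + s, β 2]) h8
  simp at hA hB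
  refine mem_closure_of_curve (fun t => ((α, β, ![t * m, t * n, 0]), s)) (by fun_prop) ?_ ?_
  · have : w = ![0 * m, 0 * n, 0] := by
      ext i
      fin_cases i <;> simp [h0, h1, h2]
    simp [this]
  · filter_upwards [self_mem_nhdsWithin] with t ht
    have ht : t ≠ 0 := ht
    refine ⟨?_, ?_⟩
    · rw [mem_algebraicO_iff]
      refine ⟨hp, ?_, ?_, ?_, ?_, ?_⟩ <;> simp
      · linear_combination 2 * t * hA
      · linear_combination 2 * t * hB
      · linarith
      · linarith
      · linarith
    · rw [w₁_ne_zero_iff]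
      have : 0 < t ^ 2 * (m ^ 2 + n ^ 2) := by positivity
      simp
      linarith

/-- Here α and β are horizontal. Rotating both about the first axis preserves the phase space
constraints; then A × B = (sω₃/2)M can be solved for ω, and the orthogonality relations follow from
it. -/
lemma mem_completedO_of_vertical {a b : ℝ} (ha : 0 < a) (hb : 0 < b) {α β w : Fin 3 → ℝ}
    {s : ℝ} (hs : s ≠ 0)
    (hu : ((α, β, w), s) ∈ algebraicO a b) (h0 : w 0 = 0) (h1 : w 1 = 0) (h2 : w 2 ≠ 0) :
    ((α, β, w), s) ∈ completedO a b := by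
  rw [mem_algebraicO_iff] at hu
  obtain ⟨⟨p1, p2, p3⟩, h4, h5, h6, h7, h8⟩ := hu
  have hα : α 2 = 0 := by simpa [h0, h1, h2] using h4
  have hβ : β 2 = 0 := by simpa [h0, h1, h2] using h5
  simp only [hα, hβ, mul_zero, add_zero, ne_eq, OfNat.ofNat_ne_zero, not_false_eq_true,
    zero_pow] at p1 p2 p3
  -- the third component of the vector product along the rotation about the first axis
  set N : ℝ → ℝ := fun t => (α 0 + s) * (Real.cos t * β 1 + s) - Real.cos t * α 1 * β 0 with hN
  have hN0 : N 0 = s / 2 * w 2 ^ 2 := by simp [hN, ← h8]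
  have hNc : Continuous N := by fun_prop
  have hN0' : N 0 ≠ 0 := by rw [hN0]; positivity
  -- This is the solution ω₃ of sω₃²/2 = N(t) on the branch with the sign of its initial value.
  set V : ℝ → ℝ := fun t => w 2 * Real.sqrt (N t / N 0) with hV
  have hVc : Continuous V := by fun_prop
  have hV0 : V 0 = w 2 := by simp [hV, hN0']
  refine mem_closure_of_curve (fun t =>
    ((![α 0, Real.cos t * α 1, Real.sin t * α 1], ![β 0, Real.cos t * β 1, Real.sin t * β 1],
      ![-(Real.sin t * s * α 1) / (s * V t),
        Real.sin t * (α 1 * β 0 - (α 0 + s) * β 1) / (s * V t), V t]), s)) ?_ ?_ ?_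
  · have : s * V 0 ≠ 0 := by rw [hV0]; positivity
    fun_prop (disch := assumption)
  · have hα' : α = ![α 0, α 1, 0] := by ext i; fin_cases i <;> simp [hα]
    have hβ' : β = ![β 0, β 1, 0] := by ext i; fin_cases i <;> simp [hβ]
    have hw' : w = ![0, 0, w 2] := by ext i; fin_cases i <;> simp [h0, h1]
    rw [hα', hβ', hw']
    simp [hV0]
  · have hpos : ∀ᶠ t in 𝓝[≠] (0 : ℝ), 0 < N t / N 0 := by
      have hc : ContinuousAt (fun t => N t / N 0) 0 := by fun_prop
      have : ∀ᶠ t in 𝓝 (0 : ℝ), 0 < N t / N 0 :=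
        hc.eventually (lt_mem_nhds (by simp [div_self hN0']))
      exact this.filter_mono nhdsWithin_le_nhds
    have hsin : ∀ᶠ t in 𝓝[≠] (0 : ℝ), Real.sin t ≠ 0 := by
      have := (Real.hasDerivAt_sin 0).eventually_ne (c := 0) (by simp)
      simpa using this
    filter_upwards [hpos, hsin] with t ht hst
    have hVt : V t ≠ 0 := mul_ne_zero h2 (Real.sqrt_pos.2 ht).ne'
    have hV2 : s / 2 * V t ^ 2 = N t := by
      simp only [hV]
      rw [mul_pow, Real.sq_sqrt ht.le]
      field_simp
      rw [hN0]
      ring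
    have hcs := Real.sin_sq_add_cos_sq t
    refine ⟨?_, ?_⟩
    · rw [mem_algebraicO_iff]
      refine ⟨⟨?_, ?_, ?_⟩, ?_, ?_, ?_, ?_, ?_⟩ <;> simp
      · linear_combination p1 + α 1 ^ 2 * hcs
      · linear_combination p2 + β 1 ^ 2 * hcs
      · linear_combination p3 + α 1 * β 1 * hcs
      · field_simp
        simp only [hN] at hV2
        linear_combination 2 * Real.sin t * α 1 * hV2
      · field_simp
        simp only [hN] at hV2
        linear_combination 2 * Real.sin t * β 1 * hV2
      · field_simp
        ring
      · field_simp
      · rw [hV2]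
    · rw [w₁_ne_zero_iff]
      simp only [Matrix.cons_val_zero, Matrix.cons_val_one]
      -- The numerator of ω₁ is proportional to α₂. If α₂ = 0, then A₁ ≠ 0 and β₂ ≠ 0, so the
      -- numerator of ω₂ survives.
      by_cases hα1 : α 1 = 0
      · have : α 0 + s ≠ 0 := by
          intro h
          apply hN0'
          simp [hN, hα1, h]
        have hβ1 : β 1 ≠ 0 := by
          intro h
          have hβ0 : α 0 * β 0 = 0 := by simpa [h] using p3
          have hα0 : α 0 ≠ 0 := by
            rintro h'
            simp [h', hα1] at p1
            exact (pow_pos ha 2).ne p1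
          have := (mul_eq_zero.1 hβ0).resolve_left hα0
          simp [h, this] at p2
          exact (pow_pos hb 2).ne p2
        have : Real.sin t * (α 1 * β 0 - (α 0 + s) * β 1) / (s * V t) ≠ 0 := by
          rw [hα1]
          refine div_ne_zero (mul_ne_zero hst ?_) (mul_ne_zero hs hVt)
          simpa using ⟨this, hβ1⟩
        positivity
      · have : -(Real.sin t * s * α 1) / (s * V t) ≠ 0 :=
          div_ne_zero (neg_ne_zero.2 (mul_ne_zero (mul_ne_zero hst hs) hα1)) (mul_ne_zero hs hVt)
        positivity

theorem completedO_eq {a b : ℝ} (hb : 0 < b) (hab : b < a) :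
    completedO a b = algebraicO a b := by
  apply Set.Subset.antisymm
  · rw [completedO, graph_eq]
    exact closure_minimal (fun q hq => hq.1) (isClosed_algebraicO a b)
  · rintro ⟨⟨α, β, w⟩, s⟩ hu
    by_cases hw : w₁ (α, β, w) = 0
    · have h := mt w₁_ne_zero_iff.2 (not_not.2 hw)
      simp only at h
      have h0 : w 0 = 0 := by nlinarith [sq_nonneg (w 0), sq_nonneg (w 1)]
      have h1 : w 1 = 0 := by nlinarith [sq_nonneg (w 0), sq_nonneg (w 1)]
      by_cases h2 : w 2 = 0
      · exact mem_completedO_of_horizontal hu h0 h1 h2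
      · exact mem_completedO_of_vertical (hb.trans hab) hb (ne_zero_of_mem hb hab hu) hu h0 h1 h2
    · rw [completedO, graph_eq]
      exact subset_closure ⟨hu, hw⟩

/-! ### The separating set. -/

open Polynomial in
lemma separable_X_sq_sub_C_iff {c : ℝ} : (X ^ 2 - C c : ℝ[X]).Separable ↔ c ≠ 0 := by
  constructor
  · rintro h rfl
    have h' : (X * X : ℝ[X]).Separable := by simpa [sq] using h
    exact not_isUnit_X ((isCoprime_self).1 h'.isCoprime)
  · intro h
    exact separable_X_pow_sub_C c (by norm_num) h

open Polynomial in
lemma isCoprime_X_sq_sub_C_iff {c d : ℝ} :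
    IsCoprime (X ^ 2 - C c : ℝ[X]) (X ^ 2 - C d) ↔ c ≠ d := by
  constructor
  · rintro h rfl
    have := natDegree_eq_zero_of_isUnit (isCoprime_self.1 h)
    rw [natDegree_X_pow_sub_C] at this
    norm_num at this
  · intro h
    have hcd : d - c ≠ 0 := sub_ne_zero.2 h.symm
    refine ⟨C (d - c)⁻¹, -C (d - c)⁻¹, ?_⟩
    have : C (d - c)⁻¹ * (X ^ 2 - C c) + -C (d - c)⁻¹ * (X ^ 2 - C d)
        = C ((d - c)⁻¹ * (d - c)) := by
      rw [C_mul, C_sub]; ring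
    rw [this, inv_mul_cancel₀ hcd, C_1]

open Polynomial in
lemma isCoprime_X_sub_C_iff {p : ℝ[X]} {r : ℝ} : IsCoprime p (X - C r) ↔ p.eval r ≠ 0 := by
  rw [isCoprime_comm, (irreducible_X_sub_C r).coprime_iff_not_dvd, dvd_iff_isRoot, IsRoot]

-- The roots of the third factor are ±r² − τ. At them the first two factors take the values 4τ(b² −
-- s²), 4τb² and 4τ(a² − s²), 4τa², so every coincidence of roots is an explicit factored condition.
open Polynomial in
lemma mem_separatingSet_iff {a b s τ : ℝ} (hb : 0 < b) (hab : b < a) :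
    (s, τ) ∈ separatingSet a b ↔ s = 0 ∨ τ = 0 ∨ sigma a b τ = 0 ∨
      4 * s ^ 2 * τ + sigma a b τ = 0 ∨ s ^ 2 = a ^ 2 ∨ s ^ 2 = b ^ 2 := by
  have hr : 0 < a ^ 2 - b ^ 2 := by nlinarith
  set r := a ^ 2 - b ^ 2 with hrdef
  have h3 : ((X + C τ) ^ 2 - C ((a ^ 2 - b ^ 2) ^ 2) : ℝ[X]) =
      (X - C (r - τ)) * (X - C (-r - τ)) := by
    simp only [← hrdef, C_pow, C_sub, C_neg]; ring
  have h3s : ((X - C (r - τ)) * (X - C (-r - τ))).Separable :=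
    (separable_X_sub_C).mul separable_X_sub_C
      (by rw [isCoprime_X_sub_C_iff]; simp; linarith)
  have key : (maximalPolynomial a b s τ).Separable ↔
      (4 * s ^ 2 * τ + sigma a b τ ≠ 0 ∧ sigma a b τ ≠ 0 ∧
        4 * s ^ 2 * τ + sigma a b τ ≠ sigma a b τ) ∧
      (((r - τ) ^ 2 - (4 * s ^ 2 * τ + sigma a b τ)) * ((r - τ) ^ 2 - sigma a b τ) ≠ 0 ∧
        ((-r - τ) ^ 2 - (4 * s ^ 2 * τ + sigma a b τ)) * ((-r - τ) ^ 2 - sigma a b τ) ≠ 0) := by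
    rw [maximalPolynomial, h3]
    constructor
    · intro h
      have h12 := h.of_mul_left
      refine ⟨⟨separable_X_sq_sub_C_iff.1 h12.of_mul_left,
        separable_X_sq_sub_C_iff.1 h12.of_mul_right, isCoprime_X_sq_sub_C_iff.1 h12.isCoprime⟩, ?_⟩
      have hc := h.isCoprime
      rw [IsCoprime.mul_right_iff, isCoprime_X_sub_C_iff, isCoprime_X_sub_C_iff] at hc
      simpa using hc
    · rintro ⟨⟨h1, h2, h12⟩, h4⟩
      refine Separable.mul (Separable.mul (separable_X_sq_sub_C_iff.2 h1)
        (separable_X_sq_sub_C_iff.2 h2) (isCoprime_X_sq_sub_C_iff.2 h12)) h3s ?_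
      rw [IsCoprime.mul_right_iff, isCoprime_X_sub_C_iff, isCoprime_X_sub_C_iff]
      simpa using h4
  have e1 : (r - τ) ^ 2 - (4 * s ^ 2 * τ + sigma a b τ) = 4 * τ * (b ^ 2 - s ^ 2) := by
    simp only [hrdef, sigma]; ring
  have e2 : (r - τ) ^ 2 - sigma a b τ = 4 * τ * b ^ 2 := by
    simp only [hrdef, sigma]; ring
  have e3 : (-r - τ) ^ 2 - (4 * s ^ 2 * τ + sigma a b τ) = 4 * τ * (a ^ 2 - s ^ 2) := by
    simp only [hrdef, sigma]; ring
  have e4 : (-r - τ) ^ 2 - sigma a b τ = 4 * τ * a ^ 2 := by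
    simp only [hrdef, sigma]; ring
  have c1 : 4 * τ * (b ^ 2 - s ^ 2) * (4 * τ * b ^ 2) = 0 ↔ τ = 0 ∨ s ^ 2 = b ^ 2 := by
    rw [show 4 * τ * (b ^ 2 - s ^ 2) * (4 * τ * b ^ 2) =
      (16 * b ^ 2) * (τ ^ 2 * (b ^ 2 - s ^ 2)) by ring, mul_eq_zero_iff_left (by positivity),
      mul_eq_zero, pow_eq_zero_iff two_ne_zero, sub_eq_zero, eq_comm (a := b ^ 2)]
  have c2 : 4 * τ * (a ^ 2 - s ^ 2) * (4 * τ * a ^ 2) = 0 ↔ τ = 0 ∨ s ^ 2 = a ^ 2 := by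
    have ha : 0 < a := hb.trans hab
    rw [show 4 * τ * (a ^ 2 - s ^ 2) * (4 * τ * a ^ 2) =
      (16 * a ^ 2) * (τ ^ 2 * (a ^ 2 - s ^ 2)) by ring, mul_eq_zero_iff_left (by positivity),
      mul_eq_zero, pow_eq_zero_iff two_ne_zero, sub_eq_zero, eq_comm (a := a ^ 2)]
  have c3 : 4 * s ^ 2 * τ + sigma a b τ = sigma a b τ ↔ s = 0 ∨ τ = 0 := by
    simp
  rw [e1, e2, e3, e4] at key
  simp only [ne_eq, c1, c2, c3] at key
  change ¬ (maximalPolynomial a b s τ).Separable ↔ _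
  rw [key]
  generalize (4 * s ^ 2 * τ + sigma a b τ = 0) = q1, (sigma a b τ = 0) = q2, (s = 0) = q3,
    (τ = 0) = q4, (s ^ 2 = a ^ 2) = q5, (s ^ 2 = b ^ 2) = q6
  clear key h3s h3 e1 e2 e3 e4 c1 c2 c3
  tauto

lemma sigma_eq (a b τ : ℝ) : sigma a b τ = (τ - (a - b) ^ 2) * (τ - (a + b) ^ 2) := by
  unfold sigma; ring

/-! ### Differentials and nonregular points. -/

/-- A function that is quadratic along a line has the expected symmetric-difference derivative. -/
lemma fderiv_apply_of_quadratic {E : Type*} [NormedAddCommGroup E] [NormedSpace ℝ E]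
    {L : E → ℝ} {q v : E} (hL : DifferentiableAt ℝ L q)
    (h : ∀ t : ℝ, L (q + t • v) = L q + t * ((L (q + v) - L (q - v)) / 2)
      + t ^ 2 * ((L (q + v) + L (q - v) - 2 * L q) / 2)) :
    fderiv ℝ L q v = (L (q + v) - L (q - v)) / 2 := by
  have h1 : HasDerivAt (fun t : ℝ => L (q + t • v)) (fderiv ℝ L q v) 0 :=
    hL.hasFDerivAt.hasLineDerivAt v
  have h2 : HasDerivAt (fun t : ℝ => L (q + t • v)) ((L (q + v) - L (q - v)) / 2) 0 := by
    simp only [h]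
    set c := (L (q + v) - L (q - v)) / 2
    set d := (L (q + v) + L (q - v) - 2 * L q) / 2
    have := (((hasDerivAt_id (0 : ℝ)).mul_const c).const_add (L q)).add
      (((hasDerivAt_id (0 : ℝ)).pow 2).mul_const d)
    exact this.congr_deriv (by simp)
  exact h1.unique h2

/-- Coordinate directions in `State × ℝ`. -/
def dirα (i : Fin 3) : State × ℝ := ((Pi.single i 1, 0, 0), 0)
def dirβ (i : Fin 3) : State × ℝ := ((0, Pi.single i 1, 0), 0)
def dirω (i : Fin 3) : State × ℝ := ((0, 0, Pi.single i 1), 0)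
def dirS : State × ℝ := (0, 1)

lemma eq_sum_dir (v : State × ℝ) : v = ∑ i, v.1.1 i • dirα i + ∑ i, v.1.2.1 i • dirβ i
    + ∑ i, v.1.2.2 i • dirω i + v.2 • dirS := by
  obtain ⟨⟨x, y, z⟩, s⟩ := v
  ext i <;> simp [dirα, dirβ, dirω, dirS, Fin.sum_univ_three] <;> fin_cases i <;> simp

lemma clm_eq_zero_of_dir {f : State × ℝ →L[ℝ] ℝ} (hα : ∀ i, f (dirα i) = 0)
    (hβ : ∀ i, f (dirβ i) = 0) (hω : ∀ i, f (dirω i) = 0) (hS : f dirS = 0) : f = 0 := by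
  refine ContinuousLinearMap.ext fun v => ?_
  rw [eq_sum_dir v]
  simp [hα, hβ, hω, hS, Fin.sum_univ_three]

lemma contDiff_integralT : ContDiff ℝ ∞ (fun u : State × ℝ => integralT u.1) := by
  simp only [integralT_eq]
  fun_prop

lemma contDiff_integralMap : ContDiff ℝ ∞ integralMap :=
  contDiff_snd.prodMk contDiff_integralT

/-- A point is not regular if some function vanishing on the set has, at this point, the same
derivative as a nontrivial linear combination of the components of the integral map. -/
lemma not_isRegularPoint {M : Set (State × ℝ)} {q : State × ℝ} (hq : q ∈ M)
    {G : State × ℝ → ℝ} (hG : ContDiff ℝ ∞ G) (hM : ∀ u ∈ M, G u = 0) {c d : ℝ}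
    (hcd : c ≠ 0 ∨ d ≠ 0)
    (h : fderiv ℝ (fun u => G u - c * u.2 - d * integralT u.1) q = 0) :
    ¬ IsRegularPoint M integralMap q := by
  rintro ⟨W, hW, hqW, g, hg, hgM, hsurj⟩
  have hWq : W ∈ 𝓝 q := hW.mem_nhds hqW
  have hgq : ContDiffAt ℝ ∞ g q := hg.contDiffAt hWq
  have hgs := hgq.hasStrictFDerivAt (by simp)
  have hGs : HasStrictFDerivAt G (fderiv ℝ G q) q := hG.contDiffAt.hasStrictFDerivAt (by simp)
  have hFd : DifferentiableAt ℝ integralMap q := contDiff_integralMap.differentiable (by simp) q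
  have hTd : DifferentiableAt ℝ (fun u : State × ℝ => integralT u.1) q :=
    contDiff_integralT.differentiable (by simp) q
  -- Near q the level set of g lies in M, where G is identically zero; a constant is trivially
  -- extremal, so the Lagrange multiplier theorem applies.
  have hext : IsLocalExtrOn G {x | g x = g q} q := by
    refine Or.inl ?_
    have hW' : ∀ᶠ u in 𝓝[{x | g x = g q}] q, u ∈ W := nhdsWithin_le_nhds hWq
    filter_upwards [hW', self_mem_nhdsWithin] with u hu hgu
    have h0 : g q = 0 := (hgM q hqW).1 hq
    have hu' : g u = g q := hgu
    rw [hM u ((hgM u hu).2 (hu'.trans h0)), hM q hq]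
  obtain ⟨Λ, Λ₀, hne, hΛ⟩ := hext.exists_linear_map_of_hasStrictFDerivAt hgs hGs
  have hder : fderiv ℝ (fun u => (g u, integralMap u)) q
      = (fderiv ℝ g q).prod (fderiv ℝ integralMap q) :=
    (hgs.hasFDerivAt.prodMk hFd.hasFDerivAt).fderiv
  have hF : fderiv ℝ integralMap q = (ContinuousLinearMap.snd ℝ State ℝ).prod
      (fderiv ℝ (fun u : State × ℝ => integralT u.1) q) :=
    (hasFDerivAt_snd.prodMk hTd.hasFDerivAt).fderiv
  have hG' : ∀ v, fderiv ℝ G q v = c * v.2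
      + d * fderiv ℝ (fun u : State × ℝ => integralT u.1) q v := by
    intro v
    have h1 := ((hGs.hasFDerivAt.sub ((hasFDerivAt_snd (𝕜 := ℝ) (p := q)).const_mul c)).sub
      (hTd.hasFDerivAt.const_mul d)).fderiv
    have h2 := DFunLike.congr_fun (h1.symm.trans h) v
    simp at h2
    linarith
  -- Surjectivity turns the multiplier relation at q into an identity in independent variables,
  -- which forces both multipliers to vanish.
  have key : ∀ (x : Fin 6 → ℝ) (s t : ℝ), Λ x + Λ₀ * (c * s + d * t) = 0 := by
    intro x s t
    obtain ⟨v, hv⟩ := hsurj (x, s, t)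
    rw [hder, hF] at hv
    simp only [ContinuousLinearMap.prod_apply, Prod.mk.injEq] at hv
    have := hΛ v
    rw [hG', hv.1, hv.2.2, smul_eq_mul] at this
    have h2 : v.2 = s := hv.2.1
    rwa [h2] at this
  apply hne
  have hΛ0 : Λ = 0 := by
    refine LinearMap.ext fun x => ?_
    simpa using key x 0 0
  have h1 := key 0 1 0
  have h2 := key 0 0 1
  simp at h1 h2
  rw [hΛ0, Prod.mk_eq_zero]
  exact ⟨rfl, by tauto⟩

/-! ### The hermitian relation and the multiplier equations. -/

/-- The equations of `algebraicO` in terms of `A = α + s e₁` and `B = β + s e₂`, together with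
the value `τ` of the integral `T`. -/
structure TiltedEquations (a b s τ A1 A2 A3 B1 B2 B3 w1 w2 w3 : ℝ) : Prop where
  p1 : (A1 - s) ^ 2 + A2 ^ 2 + A3 ^ 2 = a ^ 2
  p2 : B1 ^ 2 + (B2 - s) ^ 2 + B3 ^ 2 = b ^ 2
  p3 : (A1 - s) * B1 + A2 * (B2 - s) + A3 * B3 = 0
  hA : 2 * A1 * w1 + 2 * A2 * w2 + A3 * w3 = 0
  hB : 2 * B1 * w1 + 2 * B2 * w2 + B3 * w3 = 0
  d1 : A2 * B3 - A3 * B2 = s * w3 * w1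
  d2 : A3 * B1 - A1 * B3 = s * w3 * w2
  d3 : A1 * B2 - A2 * B1 = s / 2 * w3 ^ 2
  hτ : τ = a ^ 2 + b ^ 2 - 2 * ((A1 - s) * (B2 - s) - A2 * B1) - 2 * s * (w1 ^ 2 + w2 ^ 2)

variable {a b s τ A1 A2 A3 B1 B2 B3 w1 w2 w3 : ℝ}

lemma tiltedEquations_of_mem {α β w : Fin 3 → ℝ} (h : ((α, β, w), s) ∈ algebraicO a b) :
    TiltedEquations a b s (integralT (α, β, w)) (α 0 + s) (α 1) (α 2) (β 0) (β 1 + s) (β 2)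
      (w 0) (w 1) (w 2) := by
  have hT := integralT_of_mem h
  rw [mem_algebraicO_iff] at h
  obtain ⟨⟨p1, p2, p3⟩, hA, hB, d1, d2, d3⟩ := h
  simp only at hT
  constructor <;> try simp only [add_sub_cancel_right]
  all_goals assumption

lemma eq_zero_of_sq_add_sq {x y : ℝ} (h : x ^ 2 + y ^ 2 = 0) : x = 0 ∧ y = 0 :=
  ⟨by nlinarith [sq_nonneg x, sq_nonneg y], by nlinarith [sq_nonneg x, sq_nonneg y]⟩

namespace TiltedEquations

/-- The relation between the values of the integrals and the configuration. -/
lemma quadratic_relation (h : TiltedEquations a b s τ A1 A2 A3 B1 B2 B3 w1 w2 w3) :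
    τ * ((A1 + B2) ^ 2 + (A2 - B1) ^ 2)
      - 2 * (a ^ 2 - b ^ 2) * ((A1 - B2) * (A1 + B2) + (A2 + B1) * (A2 - B1))
      + (2 * (a ^ 2 + b ^ 2) - 4 * s ^ 2 - τ) * ((A1 - B2) ^ 2 + (A2 + B1) ^ 2) = 0 := by
  obtain ⟨p1, p2, p3, hA, hB, d1, d2, d3, hτ⟩ := h
  linear_combination (4 * (A1 * B2 - A2 * B1)) * hτ
    + (-2 * ((A1 - B2) ^ 2 + (A2 + B1) ^ 2)
      + 2 * ((A1 - B2) * (A1 + B2) + (A2 + B1) * (A2 - B1)) - 4 * (A1 * B2 - A2 * B1)) * p1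
    + (-2 * ((A1 - B2) ^ 2 + (A2 + B1) ^ 2)
      - 2 * ((A1 - B2) * (A1 + B2) + (A2 + B1) * (A2 - B1)) - 4 * (A1 * B2 - A2 * B1)) * p2
    + 4 * ((A2 + B1) * (A1 + B2) - (A1 - B2) * (A2 - B1)) * p3
    + 4 * (A2 * B3 - A3 * B2 + s * w3 * w1) * d1 + 4 * (A3 * B1 - A1 * B3 + s * w3 * w2) * d2
    - 8 * s * (w1 ^ 2 + w2 ^ 2) * d3

/-- An elimination identity in which conjugate quantities are treated as independent variables. -/
lemma complex_proportional {x x' Y Y' z z' w w' c s R τ : ℂ} (hx : x = -w ^ 2) (hx' : x' = -w' ^ 2)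
    (e : Y' * w + x * w' + z * c = 0) (e' : Y * w' + x' * w + z' * c = 0)
    (n : Y * Y' - x * x' = 2 * s * c ^ 2) (hR : z' ^ 2 + x' * (Y - 2 * s) = R)
    (hτ : τ = x * x' + z * z' - 2 * s * w * w') : c ^ 2 * (τ * Y - R * x) = 0 := by
  subst hx hx' hR hτ
  linear_combination (Y * z' * c) * e - Y * w * (Y' - w * w') * e'
    + w ^ 2 * (z' * c - w' * (Y - w * w')) * e' + w * w' * (Y - w * w') * n

/-- If `x₁ = -w₁²`, then `τ (y₁ + 2s) = r² x₁`. -/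
lemma proportional (h : TiltedEquations a b s τ A1 A2 A3 B1 B2 B3 w1 w2 w3) (h3 : w3 ≠ 0)
    (hX : A1 - B2 = w2 ^ 2 - w1 ^ 2) (hY : A2 + B1 = -2 * w1 * w2) :
    τ * (A1 + B2) = (a ^ 2 - b ^ 2) * (A1 - B2) ∧
      τ * (A2 - B1) = (a ^ 2 - b ^ 2) * (A2 + B1) := by
  obtain ⟨p1, p2, p3, hA, hB, d1, d2, d3, hτ⟩ := h
  have I2 := Complex.I_sq
  have h1 : (w3 : ℂ) ^ 2 * (τ * ((A1 + B2 : ℝ) + Complex.I * (A2 - B1 : ℝ))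
      - (a ^ 2 - b ^ 2 : ℝ) * ((A1 - B2 : ℝ) + Complex.I * (A2 + B1 : ℝ))) = 0 := by
    refine complex_proportional (x' := (A1 - B2 : ℝ) - Complex.I * (A2 + B1 : ℝ))
      (Y' := (A1 + B2 : ℝ) - Complex.I * (A2 - B1 : ℝ)) (z := A3 + Complex.I * B3)
      (z' := A3 - Complex.I * B3) (w := w1 + Complex.I * w2) (w' := w1 - Complex.I * w2)
      (s := s) ?_ ?_ ?_ ?_ ?_ ?_ ?_
    · rw [hX, hY]; push_cast; linear_combination (w2 ^ 2 : ℂ) * I2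
    · rw [hX, hY]; push_cast; linear_combination (w2 ^ 2 : ℂ) * I2
    all_goals apply Complex.ext <;> simp [pow_two]
    · linear_combination hA
    · linear_combination hB
    · linear_combination hA
    · linear_combination -hB
    · linear_combination 4 * d3
    · ring
    · linear_combination p1 - p2
    · linear_combination -2 * p3
    · linear_combination hτ - p1 - p2
    · ring
  have h2 := (mul_eq_zero.1 h1).resolve_left (by simpa using h3)
  have hre := congrArg Complex.re h2
  have him := congrArg Complex.im h2
  simp [pow_two] at hre him
  constructor <;> linarith

/-- Here τY = r²X, so τ times the hermitian relation collapses to −(4s²τ + σ)|X|² = 0, and |X| = ω₁²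
+ ω₂² ≠ 0. -/
lemma discriminant_eq_zero (h : TiltedEquations a b s τ A1 A2 A3 B1 B2 B3 w1 w2 w3)
    (h3 : w3 ≠ 0) (hm : w1 ^ 2 + w2 ^ 2 ≠ 0) (hX : A1 - B2 = w2 ^ 2 - w1 ^ 2)
    (hY : A2 + B1 = -2 * w1 * w2) : 4 * s ^ 2 * τ + sigma a b τ = 0 := by
  obtain ⟨g1, g2⟩ := h.proportional h3 hX hY
  have hQ := h.quadratic_relation
  have hx : (A1 - B2) ^ 2 + (A2 + B1) ^ 2 = (w1 ^ 2 + w2 ^ 2) ^ 2 := by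
    rw [hX, hY]; ring
  have hx0 : (A1 - B2) ^ 2 + (A2 + B1) ^ 2 ≠ 0 := by rw [hx]; positivity
  refine (mul_eq_zero.1 ?_).resolve_left hx0
  unfold sigma
  linear_combination -τ * hQ + (τ * (A1 + B2) - (a ^ 2 - b ^ 2) * (A1 - B2)) * g1
    + (τ * (A2 - B1) - (a ^ 2 - b ^ 2) * (A2 + B1)) * g2

/-- Both force vectors are horizontal and orthogonal, so (α × β)₃ = ±ab and τ = (a ∓ b)². -/
lemma sigma_eq_zero_of_planar (h : TiltedEquations a b s τ A1 A2 A3 B1 B2 B3 w1 w2 w3)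
    (hA3 : A3 = 0) (hB3 : B3 = 0) (hw1 : w1 = 0) (hw2 : w2 = 0) : sigma a b τ = 0 := by
  obtain ⟨p1, p2, p3, hA, hB, d1, d2, d3, hτ⟩ := h
  subst hA3 hB3 hw1 hw2
  have : ((A1 - s) * (B2 - s) - A2 * B1) ^ 2 = a ^ 2 * b ^ 2 := by
    linear_combination p1 * b ^ 2 + ((A1 - s) ^ 2 + A2 ^ 2) * p2
      - ((A1 - s) * B1 + A2 * (B2 - s)) * p3
  unfold sigma
  rw [hτ]
  linear_combination 4 * this

/-- Vanishing of the differential, in the directions of the angular velocity and of the two force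
vectors, of the combination
`P₁ |α|² + P₂ |β|² + P₃ α · β + l A · M + D · (A × B - (s ω₃ / 2) M) + n T`. -/
structure IsMultiplier (s A1 A2 A3 B1 B2 B3 w1 w2 w3 P1 P2 P3 l D1 D2 D3 n : ℝ) : Prop where
  α1 : 2 * P1 * (A1 - s) + P3 * B1 + 2 * l * w1 + (B2 * D3 - B3 * D2)
    + n * (2 * (A1 - s) - 2 * (B2 - s) + 2 * w1 ^ 2) = 0
  α2 : 2 * P1 * A2 + P3 * (B2 - s) + 2 * l * w2 + (B3 * D1 - B1 * D3)
    + n * (2 * A2 + 2 * B1 + 2 * w1 * w2) = 0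
  α3 : 2 * P1 * A3 + P3 * B3 + l * w3 + (B1 * D2 - B2 * D1) + n * (2 * A3 + w1 * w3) = 0
  β1 : 2 * P2 * B1 + P3 * (A1 - s) + (A3 * D2 - A2 * D3)
    + n * (2 * B1 + 2 * A2 + 2 * w1 * w2) = 0
  β2 : 2 * P2 * (B2 - s) + P3 * A2 + (A1 * D3 - A3 * D1)
    + n * (2 * (B2 - s) - 2 * (A1 - s) + 2 * w2 ^ 2) = 0
  β3 : 2 * P2 * B3 + P3 * A3 + (A2 * D1 - A1 * D2) + n * (2 * B3 + w2 * w3) = 0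
  ω1 : 2 * l * A1 - s * w3 * D1
    + n * (4 * (A1 - s) * w1 + 2 * A2 * w2 + A3 * w3 + 2 * B1 * w2) = 0
  ω2 : 2 * l * A2 - s * w3 * D2
    + n * (2 * A2 * w1 + 2 * B1 * w1 + 4 * (B2 - s) * w2 + B3 * w3) = 0
  ω3 : l * A3 - s * w1 * D1 - s * w2 * D2 - s * w3 * D3 + n * (A3 * w1 + B3 * w2) = 0

variable {P1 P2 P3 l D1 D2 D3 n : ℝ}

/-- The surviving multipliers are those of the identity A·(A × B − (sω₃/2)M) = −(sω₃/2) A·M, which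
holds among the equations themselves. A nonzero coefficient of T would force σ = 0 or 4s²τ + σ = 0.
-/
lemma multiplier_of_ne (h : TiltedEquations a b s τ A1 A2 A3 B1 B2 B3 w1 w2 w3)
    (hs : s ≠ 0) (hσ : sigma a b τ ≠ 0) (hdisc : 4 * s ^ 2 * τ + sigma a b τ ≠ 0)
    (h3 : w3 ≠ 0) (E : IsMultiplier s A1 A2 A3 B1 B2 B3 w1 w2 w3 P1 P2 P3 l D1 D2 D3 n) :
    n = 0 ∧ ∃ ρ, D1 = ρ * A1 ∧ D2 = ρ * A2 ∧ D3 = ρ * A3 ∧ 2 * l = ρ * s * w3 := by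
  have h' := h
  obtain ⟨p1, p2, p3, hA, hB, d1, d2, d3, hτ⟩ := h'
  obtain ⟨e1, e2, e3, f1, f2, f3, g1, g2, g3⟩ := E
  -- The ω-equations are linear in D with coefficient sω₃ ≠ 0. These rescaled unknowns let D be
  -- solved as ρA + ρ'B plus a term in ν, without denominators.
  obtain ⟨ρ, hρ⟩ : ∃ ρ, 2 * (l + n * w1) = ρ * s * w3 :=
    ⟨2 * (l + n * w1) / (s * w3), by field_simp⟩
  obtain ⟨ρ', hρ'⟩ : ∃ ρ', 2 * (n * w2) = ρ' * s * w3 :=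
    ⟨2 * (n * w2) / (s * w3), by field_simp⟩
  obtain ⟨ν, hν⟩ : ∃ ν, n = ν * w3 ^ 2 := ⟨n / w3 ^ 2, by field_simp⟩
  have hsw : s * w3 ≠ 0 := mul_ne_zero hs h3
  have hD1 : D1 = ρ * A1 + ρ' * B1 - 4 * ν * w1 * w3 := by
    refine mul_left_cancel₀ hsw ?_
    linear_combination -g1 + n * hA + A1 * hρ + B1 * hρ' - 4 * s * w1 * hν
  have hD2 : D2 = ρ * A2 + ρ' * B2 - 4 * ν * w2 * w3 := by
    refine mul_left_cancel₀ hsw ?_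
    linear_combination -g2 + n * hB + A2 * hρ + B2 * hρ' - 4 * s * w2 * hν
  have hD3 : D3 = ρ * A3 + ρ' * B3 + 4 * ν * (w1 ^ 2 + w2 ^ 2) := by
    refine mul_left_cancel₀ hsw ?_
    linear_combination -g3 + A3 / 2 * hρ + B3 / 2 * hρ' - s * w1 * hD1 - s * w2 * hD2
      - s * ρ / 2 * hA - s * ρ' / 2 * hB
  have e1' : 2 * (P1 + n) * (A1 - s) + P3 * B1 + 4 * ν * (B2 * (w1 ^ 2 + w2 ^ 2) + B3 * w2 * w3)
      - 2 * n * (B2 - s) = 0 := by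
    linear_combination e1 - w1 * hρ + ρ * d1 - B2 * hD3 + B3 * hD2
  have e2' : 2 * (P1 + n) * A2 + P3 * (B2 - s) - 4 * ν * (B3 * w1 * w3 + B1 * (w1 ^ 2 + w2 ^ 2))
      + 2 * n * B1 = 0 := by
    linear_combination e2 - w2 * hρ + ρ * d2 - B3 * hD1 + B1 * hD3
  have e3' : 2 * (P1 + n) * A3 + P3 * B3 + 4 * ν * (B2 * w1 - B1 * w2) * w3 = 0 := by
    linear_combination e3 - w3 / 2 * hρ + ρ * d3 - B1 * hD2 + B2 * hD1
  have f1' : 2 * (P2 + n) * B1 + P3 * (A1 - s) - 4 * ν * (A3 * w2 * w3 + A2 * (w1 ^ 2 + w2 ^ 2))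
      + 2 * n * A2 = 0 := by
    linear_combination f1 - w1 * hρ' + ρ' * d1 - A3 * hD2 + A2 * hD3
  have f2' : 2 * (P2 + n) * (B2 - s) + P3 * A2 + 4 * ν * (A1 * (w1 ^ 2 + w2 ^ 2) + A3 * w1 * w3)
      - 2 * n * (A1 - s) = 0 := by
    linear_combination f2 - w2 * hρ' + ρ' * d2 - A1 * hD3 + A3 * hD1
  have f3' : 2 * (P2 + n) * B3 + P3 * A3 + 4 * ν * (A1 * w2 - A2 * w1) * w3 = 0 := by
    linear_combination f3 - w3 / 2 * hρ' + ρ' * d3 - A2 * hD1 + A1 * hD2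
  clear e1 e2 e3 f1 f2 f3 g1 g2 g3
  subst hν
  -- The infinitesimal rotations α × ∂α + β × ∂β annihilate |α|², |β|² and α·β, so their horizontal
  -- components remove P₁, P₂, P₃.
  have k1 : ν * (w2 * (w1 ^ 2 + w2 ^ 2 - (A1 - B2)) + w1 * (A2 + B1)) = 0 := by
    refine (mul_eq_zero.1 ?_).resolve_left (mul_ne_zero four_ne_zero hsw)
    linear_combination A2 * e3' - A3 * e2' + (B2 - s) * f3' - B3 * f2'
      + 2 * ν * w3 * B1 * hA - 2 * ν * w3 * A1 * hB - 4 * ν * (w1 ^ 2 + w2 ^ 2) * d2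
      + 2 * ν * s * w3 * hB
  have k2 : ν * (w1 * (w1 ^ 2 + w2 ^ 2 + (A1 - B2)) + w2 * (A2 + B1)) = 0 := by
    refine (mul_eq_zero.1 ?_).resolve_left (mul_ne_zero four_ne_zero hsw)
    linear_combination -(A3 * e1' - (A1 - s) * e3' + B3 * f1' - B1 * f3')
      - 2 * ν * w3 * B2 * hA + 2 * ν * w3 * A2 * hB - 4 * ν * (w1 ^ 2 + w2 ^ 2) * d1
      + 2 * ν * s * w3 * hA
  -- If ν ≠ 0, the two relations say that ω₁ = ω₂ = 0 or x₁ = −w₁². The first case makes the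
  -- configuration planar, the second annihilates the discriminant.
  have hν0 : ν = 0 := by
    by_contra hne
    replace k1 := (mul_eq_zero.1 k1).resolve_left hne
    replace k2 := (mul_eq_zero.1 k2).resolve_left hne
    by_cases hm : w1 ^ 2 + w2 ^ 2 = 0
    · obtain ⟨hw1, hw2⟩ := eq_zero_of_sq_add_sq hm
      refine hσ (h.sigma_eq_zero_of_planar ?_ ?_ hw1 hw2)
      · simpa [hw1, hw2, h3] using hA
      · simpa [hw1, hw2, h3] using hB
    · refine hdisc (h.discriminant_eq_zero h3 hm ?_ ?_) <;> refine mul_left_cancel₀ hm ?_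
      · linear_combination w1 * k2 - w2 * k1
      · linear_combination w2 * k2 + w1 * k1
  subst hν0
  have hρ0 : ρ' = 0 := by
    refine (mul_eq_zero.1 ?_).resolve_right hsw
    linear_combination -hρ'
  subst hρ0
  exact ⟨zero_mul _, ρ, by rw [hD1]; ring, by rw [hD2]; ring, by rw [hD3]; ring,
    by linear_combination hρ⟩

/-- If `ω₃ = 0`, then `A` and `B` are proportional. -/
lemma exists_proportional (h : TiltedEquations a b s τ A1 A2 A3 B1 B2 B3 w1 w2 w3)
    (ha : s ^ 2 ≠ a ^ 2) (hb : s ^ 2 ≠ b ^ 2) (h3 : w3 = 0) :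
    ∃ κ, κ ≠ 0 ∧ B1 = κ * A1 ∧ B2 = κ * A2 ∧ B3 = κ * A3 ∧ A2 - κ * A1 ≠ 0 := by
  obtain ⟨p1, p2, p3, hA, hB, d1, d2, d3, hτ⟩ := h
  subst h3
  have hA0 : A1 ^ 2 + A2 ^ 2 + A3 ^ 2 ≠ 0 := by
    intro h0
    have h1 : A1 = 0 := by nlinarith [sq_nonneg A1, sq_nonneg A2, sq_nonneg A3]
    apply ha
    subst h1
    linear_combination p1 - h0
  obtain ⟨κ, hκ⟩ : ∃ κ, κ * (A1 ^ 2 + A2 ^ 2 + A3 ^ 2) = A1 * B1 + A2 * B2 + A3 * B3 :=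
    ⟨(A1 * B1 + A2 * B2 + A3 * B3) / (A1 ^ 2 + A2 ^ 2 + A3 ^ 2), by field_simp⟩
  have h1 : B1 = κ * A1 := by
    refine mul_left_cancel₀ hA0 ?_
    linear_combination -A1 * hκ + A3 * d2 - A2 * d3
  have h2 : B2 = κ * A2 := by
    refine mul_left_cancel₀ hA0 ?_
    linear_combination -A2 * hκ - A3 * d1 + A1 * d3
  have h3 : B3 = κ * A3 := by
    refine mul_left_cancel₀ hA0 ?_
    linear_combination -A3 * hκ + A2 * d1 - A1 * d2
  have hκ0 : κ ≠ 0 := by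
    rintro rfl
    apply hb
    rw [h1, h2, h3] at p2
    linear_combination p2
  refine ⟨κ, hκ0, h1, h2, h3, ?_⟩
  -- If A₂ = κA₁, then α·β = 0 becomes |A|² = 2sA₁, and |α|² = a² reduces to s² = a².
  intro h0
  apply ha
  rw [h1, h2, h3] at p3
  have : A1 ^ 2 + A2 ^ 2 + A3 ^ 2 - 2 * s * A1 = 0 := by
    refine (mul_eq_zero.1 ?_).resolve_left hκ0
    linear_combination p3 + s * h0
  linear_combination p1 - this

/-- With ω₃ = 0 the ω-equations no longer determine D. They still give n = l = 0 via σ ≠ 0, and the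
three rotation components then make D parallel to A. -/
lemma multiplier_of_eq (h : TiltedEquations a b s τ A1 A2 A3 B1 B2 B3 w1 w2 w3)
    (hs : s ≠ 0) (hσ : sigma a b τ ≠ 0) (ha : s ^ 2 ≠ a ^ 2) (hb : s ^ 2 ≠ b ^ 2)
    (h3 : w3 = 0) (E : IsMultiplier s A1 A2 A3 B1 B2 B3 w1 w2 w3 P1 P2 P3 l D1 D2 D3 n) :
    n = 0 ∧ ∃ ρ, D1 = ρ * A1 ∧ D2 = ρ * A2 ∧ D3 = ρ * A3 ∧ 2 * l = ρ * s * w3 := by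
  obtain ⟨κ, hκ0, hB1, hB2, hB3, hne⟩ := h.exists_proportional ha hb h3
  have hA12 : A1 = 0 → A2 = 0 → False := by
    rintro rfl rfl
    simp at hne
  have hplanar := h.sigma_eq_zero_of_planar
  obtain ⟨p1, p2, p3, hA, hB, d1, d2, d3, hτ⟩ := h
  obtain ⟨e1, e2, e3, f1, f2, f3, g1, g2, g3⟩ := E
  subst h3 hB1 hB2 hB3
  have hnl : n = 0 ∧ l = 0 := by
    -- Contracting the ω-equations with (ω₁, ω₂) leaves only −4sn(ω₁² + ω₂²), by A·M = B·M = 0.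
    have hm0 : n * (w1 ^ 2 + w2 ^ 2) = 0 := by
      refine (mul_eq_zero.1 ?_).resolve_left hs
      linear_combination -(w1 * g1 + w2 * g2) / 4 + ((l + n * w1) / 4 + n * w1 / 4) * hA
        + n * w2 / 2 * hB
    have hl : n = 0 ∨ (w1 = 0 ∧ w2 = 0) → l = 0 := by
      intro h
      have k1 : l * A1 = 0 := by
        obtain rfl | ⟨rfl, rfl⟩ := h <;> linear_combination g1 / 2
      have k2 : l * A2 = 0 := by
        obtain rfl | ⟨rfl, rfl⟩ := h <;> linear_combination g2 / 2
      by_contra hl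
      exact hA12 ((mul_eq_zero.1 k1).resolve_left hl) ((mul_eq_zero.1 k2).resolve_left hl)
    have hn : n = 0 := by
      by_contra hn
      obtain ⟨hw1, hw2⟩ := eq_zero_of_sq_add_sq ((mul_eq_zero.1 hm0).resolve_left hn)
      have hl0 := hl (Or.inr ⟨hw1, hw2⟩)
      subst hw1 hw2 hl0
      have hA3 : A3 = 0 := by
        have hc : 2 * n * s * (κ ^ 2 + 1) ≠ 0 := by positivity
        refine (mul_eq_zero.1 ?_).resolve_left hc
        linear_combination (A3 * e1 - (A1 - s) * e3 + κ * A3 * f1 - κ * A1 * f3)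
          - κ * (A2 * e3 - A3 * e2 + (κ * A2 - s) * f3 - κ * A3 * f2)
      exact hσ (hplanar hA3 (by rw [hA3, mul_zero]) rfl rfl)
    exact ⟨hn, hl (Or.inl hn)⟩
  obtain ⟨rfl, rfl⟩ := hnl
  obtain ⟨ρ, hρ⟩ : ∃ ρ, ρ * (A2 - κ * A1) = D2 - κ * D1 :=
    ⟨(D2 - κ * D1) / (A2 - κ * A1), by field_simp⟩
  have hs' : s * (A2 - κ * A1) ≠ 0 := mul_ne_zero hs hne
  refine ⟨rfl, ρ, ?_, ?_, ?_, by ring⟩ <;> refine mul_left_cancel₀ hs' ?_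
  · linear_combination -s * A1 * hρ - (A2 * e3 - A3 * e2 + (κ * A2 - s) * f3 - κ * A3 * f2)
  · linear_combination -s * A2 * hρ - (A3 * e1 - (A1 - s) * e3 + κ * A3 * f1 - κ * A1 * f3)
  · linear_combination -s * A3 * hρ
      - ((A1 - s) * e2 - A2 * e1 + κ * A1 * f2 - (κ * A2 - s) * f1)

end TiltedEquations

/-! ### Regularity through six local equations. -/

/-- A linear combination of the defining functions of `algebraicO`, of `s` and of `T`. -/
def lagrangian (a b P1 P2 P3 l : ℝ) (D : Fin 3 → ℝ) (c n : ℝ) (u : State × ℝ) : ℝ :=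
  P1 * (u.1.1 0 ^ 2 + u.1.1 1 ^ 2 + u.1.1 2 ^ 2 - a ^ 2)
    + P2 * (u.1.2.1 0 ^ 2 + u.1.2.1 1 ^ 2 + u.1.2.1 2 ^ 2 - b ^ 2)
    + P3 * (u.1.1 0 * u.1.2.1 0 + u.1.1 1 * u.1.2.1 1 + u.1.1 2 * u.1.2.1 2)
    + l * dotA u + (D 0 * defect u 0 + D 1 * defect u 1 + D 2 * defect u 2)
    + c * u.2 + n * integralT u.1

variable {a b P1 P2 P3 l c n : ℝ} {D : Fin 3 → ℝ}

lemma differentiable_lagrangian : Differentiable ℝ (lagrangian a b P1 P2 P3 l D c n) := by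
  unfold lagrangian dotA defect
  simp only [integralT_eq, Matrix.cons_val]
  fun_prop

lemma lagrangian_quadratic_α (q : State × ℝ) (i : Fin 3) (t : ℝ) :
    let L := lagrangian a b P1 P2 P3 l D c n
    L (q + t • dirα i) = L q + t * ((L (q + dirα i) - L (q - dirα i)) / 2)
      + t ^ 2 * ((L (q + dirα i) + L (q - dirα i) - 2 * L q) / 2) := by
  obtain ⟨⟨α, β, w⟩, s⟩ := q
  fin_cases i <;> simp [lagrangian, dotA, defect, integralT_eq, dirα] <;> ring

lemma lagrangian_quadratic_β (q : State × ℝ) (i : Fin 3) (t : ℝ) :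
    let L := lagrangian a b P1 P2 P3 l D c n
    L (q + t • dirβ i) = L q + t * ((L (q + dirβ i) - L (q - dirβ i)) / 2)
      + t ^ 2 * ((L (q + dirβ i) + L (q - dirβ i) - 2 * L q) / 2) := by
  obtain ⟨⟨α, β, w⟩, s⟩ := q
  fin_cases i <;> simp [lagrangian, dotA, defect, integralT_eq, dirβ] <;> ring

lemma lagrangian_quadratic_ω (q : State × ℝ) (i : Fin 3) (t : ℝ) :
    let L := lagrangian a b P1 P2 P3 l D c n
    L (q + t • dirω i) = L q + t * ((L (q + dirω i) - L (q - dirω i)) / 2)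
      + t ^ 2 * ((L (q + dirω i) + L (q - dirω i) - 2 * L q) / 2) := by
  obtain ⟨⟨α, β, w⟩, s⟩ := q
  fin_cases i <;> simp [lagrangian, dotA, defect, integralT_eq, dirω] <;> ring

lemma lagrangian_quadratic_S (q : State × ℝ) (t : ℝ) :
    let L := lagrangian a b P1 P2 P3 l D c n
    L (q + t • dirS) = L q + t * ((L (q + dirS) - L (q - dirS)) / 2)
      + t ^ 2 * ((L (q + dirS) + L (q - dirS) - 2 * L q) / 2) := by
  obtain ⟨⟨α, β, w⟩, s⟩ := q
  simp [lagrangian, dotA, defect, integralT_eq, dirS]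
  ring

lemma isMultiplier_of_fderiv_eq_zero {α β w : Fin 3 → ℝ} {s : ℝ}
    (h : fderiv ℝ (lagrangian a b P1 P2 P3 l D c n) ((α, β, w), s) = 0) :
    TiltedEquations.IsMultiplier s (α 0 + s) (α 1) (α 2) (β 0) (β 1 + s) (β 2) (w 0) (w 1) (w 2)
      P1 P2 P3 l (D 0) (D 1) (D 2) n := by
  have hα := fun i => fderiv_apply_of_quadratic (differentiable_lagrangian _)
    (lagrangian_quadratic_α (a := a) (b := b) (P1 := P1) (P2 := P2) (P3 := P3) (l := l) (D := D)
      (c := c) (n := n) ((α, β, w), s) i)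
  have hβ := fun i => fderiv_apply_of_quadratic (differentiable_lagrangian _)
    (lagrangian_quadratic_β (a := a) (b := b) (P1 := P1) (P2 := P2) (P3 := P3) (l := l) (D := D)
      (c := c) (n := n) ((α, β, w), s) i)
  have hω := fun i => fderiv_apply_of_quadratic (differentiable_lagrangian _)
    (lagrangian_quadratic_ω (a := a) (b := b) (P1 := P1) (P2 := P2) (P3 := P3) (l := l) (D := D)
      (c := c) (n := n) ((α, β, w), s) i)
  simp only [h, zero_apply] at hα hβ hω
  have hα0 := hα 0
  have hα1 := hα 1
  have hα2 := hα 2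
  have hβ0 := hβ 0
  have hβ1 := hβ 1
  have hβ2 := hβ 2
  have hω0 := hω 0
  have hω1 := hω 1
  have hω2 := hω 2
  simp [lagrangian, dotA, defect, integralT_eq, dirα, -zero_eq_mul] at hα0 hα1 hα2
  simp [lagrangian, dotA, defect, integralT_eq, dirβ, -zero_eq_mul] at hβ0 hβ1 hβ2
  simp [lagrangian, dotA, defect, integralT_eq, dirω, -zero_eq_mul] at hω0 hω1 hω2
  constructor
  · linear_combination -hα0
  · linear_combination -hα1
  · linear_combination -hα2
  · linear_combination -hβ0
  · linear_combination -hβ1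
  · linear_combination -hβ2
  · linear_combination -hω0
  · linear_combination -hω1
  · linear_combination -hω2

/-- The coordinates of `α + s e₁`. -/
def tilt (u : State × ℝ) : Fin 3 → ℝ := ![u.1.1 0 + u.2, u.1.1 1, u.1.1 2]

/-- Six of the defining equations of `algebraicO`; they suffice where `tilt u k ≠ 0`. -/
def localEquations (a b : ℝ) (k : Fin 3) (u : State × ℝ) : Fin 6 → ℝ :=
  ![u.1.1 0 ^ 2 + u.1.1 1 ^ 2 + u.1.1 2 ^ 2 - a ^ 2,
    u.1.2.1 0 ^ 2 + u.1.2.1 1 ^ 2 + u.1.2.1 2 ^ 2 - b ^ 2,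
    u.1.1 0 * u.1.2.1 0 + u.1.1 1 * u.1.2.1 1 + u.1.1 2 * u.1.2.1 2,
    dotA u, defect u (k + 1), defect u (k + 2)]

lemma contDiff_localEquations (a b : ℝ) (k : Fin 3) : ContDiff ℝ ∞ (localEquations a b k) := by
  unfold localEquations dotA defect
  fin_cases k <;> rw [contDiff_pi] <;> intro i <;> fin_cases i <;> simp <;> fun_prop

lemma localEquations_eq_zero_iff {a b : ℝ} {k : Fin 3} {u : State × ℝ} :
    localEquations a b k u = 0 ↔ u.1 ∈ phaseSpace a b ∧ dotA u = 0 ∧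
      defect u (k + 1) = 0 ∧ defect u (k + 2) = 0 := by
  rw [mem_phaseSpace_iff]
  simp [localEquations, sub_eq_zero, and_assoc]

/-- The identity A·(A × B − (sω₃/2)M) = −(sω₃/2) A·M makes the k-th component redundant where Aₖ ≠
0, and B·M = 0 follows as well. -/
lemma mem_algebraicO_iff_localEquations {a b : ℝ} {k : Fin 3} {u : State × ℝ}
    (hk : tilt u k ≠ 0) (hs : u.2 ≠ 0) : u ∈ algebraicO a b ↔ localEquations a b k u = 0 := by
  rw [localEquations_eq_zero_iff]
  constructor
  · rintro ⟨hp, hA, hB, hd⟩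
    exact ⟨hp, hA, by rw [hd]; rfl, by rw [hd]; rfl⟩
  · rintro ⟨hp, hA, h1, h2⟩
    have hsum : tilt u 0 * defect u 0 + tilt u 1 * defect u 1 + tilt u 2 * defect u 2 = 0 := by
      have : tilt u 0 * defect u 0 + tilt u 1 * defect u 1 + tilt u 2 * defect u 2
          = -(u.2 / 2 * u.1.2.2 2) * dotA u := by
        simp [tilt, defect, dotA]
        ring
      rw [this, hA, mul_zero]
    have h3 : defect u k = 0 := by
      refine (mul_eq_zero.1 ?_).resolve_left hk
      fin_cases k <;> simp at h1 h2 ⊢ <;> simpa [h1, h2] using hsum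
    have hd : ∀ i, defect u i = 0 := by
      intro i
      fin_cases k <;> simp at h1 h2 h3 <;> fin_cases i <;> assumption
    refine ⟨hp, hA, ?_, funext hd⟩
    have d0 := hd 0
    have d1 := hd 1
    have d2 := hd 2
    -- For ω₃ ≠ 0 the contraction of the defect with B gives B·M = 0. For ω₃ = 0 it says nothing,
    -- but then A × B = 0 and B·M is inferred from A·M.
    by_cases hw : u.1.2.2 2 = 0
    · refine (mul_eq_zero.1 ?_).resolve_left hk
      simp [defect, hw, dotA] at d0 d1 d2 hA
      fin_cases k <;> simp [tilt, dotB, hw, -mul_eq_zero]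
      · linear_combination u.1.2.1 0 * hA + 2 * u.1.2.2 1 * d2
      · linear_combination (u.1.2.1 1 + u.2) * hA - 2 * u.1.2.2 0 * d2
      · linear_combination u.1.2.1 2 * hA + 2 * u.1.2.2 0 * d1 - 2 * u.1.2.2 1 * d0
    · refine (mul_eq_zero.1 ?_).resolve_left (mul_ne_zero hs hw)
      simp [defect] at d0 d1 d2
      simp only [dotB]
      linear_combination -2 * u.1.2.1 0 * d0 - 2 * (u.1.2.1 1 + u.2) * d1 - 2 * u.1.2.1 2 * d2

/-- The multipliers of the components of `defect` given by two numbers at `k + 1`, `k + 2`. -/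
def spread (k : Fin 3) (x y : ℝ) : Fin 3 → ℝ := Pi.single (k + 1) x + Pi.single (k + 2) y

lemma spread_sum (k : Fin 3) (x y : ℝ) (v : Fin 3 → ℝ) :
    spread k x y 0 * v 0 + spread k x y 1 * v 1 + spread k x y 2 * v 2
      = x * v (k + 1) + y * v (k + 2) := by
  fin_cases k <;> simp [spread]
  ring

lemma spread_apply (k : Fin 3) (x y : ℝ) :
    spread k x y k = 0 ∧ spread k x y (k + 1) = x ∧ spread k x y (k + 2) = y := by
  fin_cases k <;> simp [spread]

lemma dual_apply (f : (Fin 6 → ℝ) × ℝ × ℝ →ₗ[ℝ] ℝ) (x : Fin 6 → ℝ) (s t : ℝ) :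
    f (x, s, t) = x 0 * f (Pi.single 0 1, 0, 0)
      + x 1 * f (Pi.single 1 1, 0, 0) + x 2 * f (Pi.single 2 1, 0, 0)
      + x 3 * f (Pi.single 3 1, 0, 0) + x 4 * f (Pi.single 4 1, 0, 0)
      + x 5 * f (Pi.single 5 1, 0, 0) + s * f (0, 1, 0) + t * f (0, 0, 1) := by
  simp only [← smul_eq_mul, ← map_smul, ← map_add]
  congr 1
  ext i <;> simp
  fin_cases i <;> simp

/-- A functional annihilating the range of the derivative becomes a set of Lagrange multipliers. -/
lemma linear_eq_lagrangian {a b : ℝ} (k : Fin 3) (f : (Fin 6 → ℝ) × ℝ × ℝ →ₗ[ℝ] ℝ) :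
    (fun u => f (localEquations a b k u, integralMap u)) =
      lagrangian a b (f (Pi.single 0 1, 0, 0)) (f (Pi.single 1 1, 0, 0)) (f (Pi.single 2 1, 0, 0))
        (f (Pi.single 3 1, 0, 0)) (spread k (f (Pi.single 4 1, 0, 0)) (f (Pi.single 5 1, 0, 0)))
        (f (0, 1, 0)) (f (0, 0, 1)) := by
  funext u
  rw [integralMap, dual_apply, lagrangian, spread_sum]
  simp [localEquations]
  ring

/-- Regularity away from the critical values. -/
lemma isRegularPoint_of_mem {a b : ℝ} (hb : 0 < b) (hab : b < a) {q : State × ℝ}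
    (hq : q ∈ completedO a b) (hsa : q.2 ^ 2 ≠ a ^ 2) (hsb : q.2 ^ 2 ≠ b ^ 2)
    (hσ : sigma a b (integralT q.1) ≠ 0)
    (hdisc : 4 * q.2 ^ 2 * integralT q.1 + sigma a b (integralT q.1) ≠ 0) :
    IsRegularPoint (completedO a b) integralMap q := by
  rw [completedO_eq hb hab] at hq ⊢
  have hs := ne_zero_of_mem hb hab hq
  obtain ⟨⟨α, β, w⟩, s⟩ := q
  have hq' := hq
  have htilt := tiltedEquations_of_mem hq
  rw [mem_algebraicO_iff] at hq'
  obtain ⟨⟨p1, p2, p3⟩, -⟩ := hq'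
  simp only at hsa hsb hσ hdisc hs
  obtain ⟨k, hk⟩ : ∃ k, tilt ((α, β, w), s) k ≠ 0 := by
    by_contra! h
    have h0 := h 0
    have h1 := h 1
    have h2 := h 2
    simp [tilt] at h0 h1 h2
    apply hsa
    rw [h1, h2] at p1
    linear_combination p1 - (α 0 - s) * h0
  refine ⟨{u | tilt u k ≠ 0 ∧ u.2 ≠ 0}, ?_, ⟨hk, hs⟩, localEquations a b k,
    (contDiff_localEquations a b k).contDiffOn,
    fun u hu => mem_algebraicO_iff_localEquations hu.1 hu.2, ?_⟩
  · have hc : Continuous fun u : State × ℝ => tilt u k := by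
      unfold tilt
      fin_cases k <;> simp <;> fun_prop
    exact (isOpen_ne_fun hc continuous_const).inter (isOpen_ne_fun continuous_snd continuous_const)
  · set Φ : State × ℝ → (Fin 6 → ℝ) × ℝ × ℝ := fun u => (localEquations a b k u, integralMap u)
      with hΦ
    have hΦd : DifferentiableAt ℝ Φ ((α, β, w), s) :=
      ((contDiff_localEquations a b k).prodMk contDiff_integralMap).differentiable (by simp) _
    by_contra hns
    have hlt : LinearMap.range (fderiv ℝ Φ ((α, β, w), s)).toLinearMap < ⊤ := by
      rw [lt_top_iff_ne_top, Ne, LinearMap.range_eq_top]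
      exact hns
    obtain ⟨f, hf0, hf⟩ := Submodule.exists_le_ker_of_lt_top _ hlt
    have hL := linear_eq_lagrangian (a := a) (b := b) k f
    set P1 := f (Pi.single 0 1, 0, 0)
    set P2 := f (Pi.single 1 1, 0, 0)
    set P3 := f (Pi.single 2 1, 0, 0)
    set l := f (Pi.single 3 1, 0, 0)
    set x := f (Pi.single 4 1, 0, 0)
    set y := f (Pi.single 5 1, 0, 0)
    set c := f (0, 1, 0)
    set n := f (0, 0, 1)
    have hder : fderiv ℝ (lagrangian a b P1 P2 P3 l (spread k x y) c n) ((α, β, w), s) = 0 := by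
      rw [← hL]
      have h1 : HasFDerivAt (fun u => f.toContinuousLinearMap (Φ u))
          (f.toContinuousLinearMap.comp (fderiv ℝ Φ ((α, β, w), s))) ((α, β, w), s) :=
        f.toContinuousLinearMap.hasFDerivAt.comp _ hΦd.hasFDerivAt
      have h2 : f.toContinuousLinearMap.comp (fderiv ℝ Φ ((α, β, w), s)) = 0 := by
        refine ContinuousLinearMap.ext fun v => ?_
        exact hf (LinearMap.mem_range_self _ v)
      rw [h2] at h1
      exact h1.fderiv
    have hE := isMultiplier_of_fderiv_eq_zero hder
    obtain ⟨hn, ρ, hD0, hD1, hD2, hl⟩ : n = 0 ∧ ∃ ρ, spread k x y 0 = ρ * (α 0 + s) ∧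
        spread k x y 1 = ρ * α 1 ∧ spread k x y 2 = ρ * α 2 ∧ 2 * l = ρ * s * w 2 := by
      by_cases h3 : w 2 = 0
      · exact htilt.multiplier_of_eq hs hσ hsa hsb h3 hE
      · exact htilt.multiplier_of_ne hs hσ hdisc h3 hE
    have hD : ∀ i, spread k x y i = ρ * tilt ((α, β, w), s) i := by
      intro i
      fin_cases i <;> assumption
    -- The omitted k-th component has multiplier 0 = ρAₖ, while Aₖ ≠ 0.
    have hρ : ρ = 0 := by
      have := hD k
      rw [(spread_apply k x y).1] at this
      exact (mul_eq_zero.1 this.symm).resolve_right hk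
    have hD' : spread k x y = 0 := by
      funext i
      rw [hD i, hρ, zero_mul]
      rfl
    have hx : x = 0 := by rw [← (spread_apply k x y).2.1, hD']; rfl
    have hy : y = 0 := by rw [← (spread_apply k x y).2.2, hD']; rfl
    have hl : l = 0 := by
      rw [hρ, zero_mul, zero_mul] at hl
      linarith
    obtain ⟨e1, e2, e3, f1, f2, f3, -, -, -⟩ := hE
    rw [hn, hl, hD'] at e1 e2 e3
    rw [hn, hD'] at f1 f2 f3
    simp at e1 e2 e3 f1 f2 f3
    have ha2 : a ^ 2 ≠ 0 := pow_ne_zero 2 (hb.trans hab).ne'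
    have hb2 : b ^ 2 ≠ 0 := by positivity
    -- The remaining equations, contracted with the orthogonal nonzero vectors α and β, isolate P₁,
    -- P₂ and P₃.
    have hP1 : P1 = 0 := by
      refine (mul_eq_zero.1 ?_).resolve_right ha2
      linear_combination -P1 * p1 + (α 0 * e1 + α 1 * e2 + α 2 * e3) / 2 - P3 / 2 * p3
    have hP2 : P2 = 0 := by
      refine (mul_eq_zero.1 ?_).resolve_right hb2
      linear_combination -P2 * p2 + (β 0 * f1 + β 1 * f2 + β 2 * f3) / 2 - P3 / 2 * p3
    have hP3 : P3 = 0 := by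
      refine (mul_eq_zero.1 ?_).resolve_right hb2
      linear_combination -P3 * p2 + (β 0 * e1 + β 1 * e2 + β 2 * e3) - 2 * P1 * p3
    have hc : c = 0 := by
      have := fderiv_apply_of_quadratic (differentiable_lagrangian _)
        (lagrangian_quadratic_S (a := a) (b := b) (P1 := P1) (P2 := P2) (P3 := P3) (l := l)
          (D := spread k x y) (c := c) (n := n) ((α, β, w), s))
      rw [hder, hP1, hP2, hP3, hl, hD', hn] at this
      simp [lagrangian, dirS] at this
      linarith
    apply hf0
    refine LinearMap.ext fun ⟨v, s', t'⟩ => ?_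
    have h := dual_apply f v s' t'
    simp only [P1, P2, P3, l, x, y, c, n] at hP1 hP2 hP3 hl hx hy hc hn
    rw [h, hP1, hP2, hP3, hl, hx, hy, hc, hn]
    simp

/-! ### Bounds on the image. -/

namespace TiltedEquations

variable {a b s τ A1 A2 A3 B1 B2 B3 w1 w2 w3 : ℝ}

lemma abs_cross_le (hb : 0 < b) (hab : b < a)
    (h : TiltedEquations a b s τ A1 A2 A3 B1 B2 B3 w1 w2 w3) :
    |(A1 - s) * (B2 - s) - A2 * B1| ≤ a * b := by
  obtain ⟨p1, p2, p3, hA, hB, d1, d2, d3, hτ⟩ := h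
  have ha : 0 < a := hb.trans hab
  refine abs_le_of_sq_le_sq ?_ (by positivity)
  have h1 : ((A1 - s) * (B2 - s) - A2 * B1) ^ 2
      ≤ ((A1 - s) ^ 2 + A2 ^ 2) * (B1 ^ 2 + (B2 - s) ^ 2) := by
    nlinarith [sq_nonneg ((A1 - s) * B1 + A2 * (B2 - s))]
  have h2 : ((A1 - s) ^ 2 + A2 ^ 2) * (B1 ^ 2 + (B2 - s) ^ 2) ≤ a ^ 2 * b ^ 2 := by
    apply mul_le_mul <;> nlinarith [sq_nonneg A3, sq_nonneg B3]
  rw [mul_pow]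
  exact h1.trans h2

/-- The squared moduli `X`, `Y` of `x₁`, `y₁ + 2s` and the real part `R` of their hermitian
product. -/
lemma exists_moduli (hb : 0 < b) (hab : b < a)
    (h : TiltedEquations a b s τ A1 A2 A3 B1 B2 B3 w1 w2 w3) :
    ∃ X Y R : ℝ, 0 ≤ X ∧ 0 ≤ Y ∧ 2 * R ≤ X + Y ∧ -(X + Y) ≤ 2 * R ∧ Y - X = 2 * s * w3 ^ 2 ∧
      τ * Y - 2 * (a ^ 2 - b ^ 2) * R + (2 * (a ^ 2 + b ^ 2) - 4 * s ^ 2 - τ) * X = 0 ∧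
      (X = 0 → R = 0) ∧ (X = 0 → Y = 0 → s ^ 2 = b ^ 2) := by
  refine ⟨(A1 - B2) ^ 2 + (A2 + B1) ^ 2, (A1 + B2) ^ 2 + (A2 - B1) ^ 2,
    (A1 - B2) * (A1 + B2) + (A2 + B1) * (A2 - B1), by positivity, by positivity,
    ?_, ?_, ?_, h.quadratic_relation, ?_, ?_⟩
  · nlinarith [sq_nonneg B2, sq_nonneg B1]
  · nlinarith [sq_nonneg A2, sq_nonneg A1]
  · linear_combination 4 * h.d3
  · intro hX
    obtain ⟨hX1, hX2⟩ := eq_zero_of_sq_add_sq hX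
    rw [hX1, hX2]
    ring
  · intro hX hY
    obtain ⟨hX1, hX2⟩ := eq_zero_of_sq_add_sq hX
    obtain ⟨hY1, hY2⟩ := eq_zero_of_sq_add_sq hY
    have hA1 : A1 = 0 := by linarith
    have hA2 : A2 = 0 := by linarith
    have hB1 : B1 = 0 := by linarith
    have hB2 : B2 = 0 := by linarith
    have p1 := h.p1
    have p2 := h.p2
    have p3 := h.p3
    simp only [hA1, hA2, hB1, hB2] at p1 p2 p3
    have h3 : A3 * B3 = 0 := by linear_combination p3
    rcases mul_eq_zero.1 h3 with h3 | h3
    · rw [h3] at p1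
      nlinarith [sq_nonneg B3]
    · rw [h3] at p2
      linear_combination p2

/-- For s > 0 one has |Y| ≥ |X|. Replacing 2 Re(X̄Y) by ±(|X|² + |Y|²) in the hermitian relation
leaves |Y|² with coefficient τ ∓ r²; once its sign is known, |Y|² ≥ |X|² leaves a multiple of |X|²
by b² − s² or a² − s². -/
lemma bounds_of_pos (hb : 0 < b) (hab : b < a)
    (h : TiltedEquations a b s τ A1 A2 A3 B1 B2 B3 w1 w2 w3) (hs : 0 < s) :
    τ ≤ (a + b) ^ 2 ∧ (a ^ 2 - b ^ 2 ≤ τ → b ^ 2 ≤ s ^ 2) ∧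
      (τ ≤ -(a ^ 2 - b ^ 2) → s ^ 2 ≤ a ^ 2) := by
  have hr : 0 < a ^ 2 - b ^ 2 := by nlinarith
  obtain ⟨X, Y, R, hX, hY, hR1, hR2, hYX, hQ, hR0, h0⟩ := h.exists_moduli hb hab
  have hYX' : X ≤ Y := by
    have : 0 ≤ 2 * s * w3 ^ 2 := by positivity
    linarith
  refine ⟨?_, ?_, ?_⟩
  · have h1 := (abs_le.1 (h.abs_cross_le hb hab)).1
    have h2 : 0 ≤ s * (w1 ^ 2 + w2 ^ 2) := by positivity
    rw [h.hτ]
    linarith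
  · intro hτ
    rcases hX.eq_or_lt with hX0 | hX0
    · refine (h0 hX0.symm ?_).ge
      rw [hR0 hX0.symm, ← hX0] at hQ
      exact (mul_eq_zero.1 (by linarith)).resolve_left (hr.trans_le hτ).ne'
    · have : 0 ≤ (s ^ 2 - b ^ 2) * X := by
        nlinarith [mul_le_mul_of_nonneg_left hR1 hr.le,
          mul_le_mul_of_nonneg_left hYX' (sub_nonneg.2 hτ)]
      linarith [nonneg_of_mul_nonneg_left this hX0]
  · intro hτ
    have hτ' : 0 ≤ -(a ^ 2 - b ^ 2) - τ := sub_nonneg.2 hτ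
    rcases hX.eq_or_lt with hX0 | hX0
    · have : s ^ 2 = b ^ 2 := by
        refine h0 hX0.symm ?_
        rw [hR0 hX0.symm, ← hX0] at hQ
        exact (mul_eq_zero.1 (by linarith)).resolve_left (by linarith : τ < 0).ne
      linarith
    · have : 0 ≤ (a ^ 2 - s ^ 2) * X := by
        nlinarith [mul_le_mul_of_nonneg_left hR2 hr.le, mul_le_mul_of_nonneg_left hYX' hτ']
      linarith [nonneg_of_mul_nonneg_left this hX0]

/-- The same argument with |Y| ≤ |X|. Now τ > 0 holds automatically, so s² ≤ a² needs no condition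
on τ. -/
lemma bounds_of_neg (hb : 0 < b) (hab : b < a)
    (h : TiltedEquations a b s τ A1 A2 A3 B1 B2 B3 w1 w2 w3) (hs : s < 0) :
    (a - b) ^ 2 ≤ τ ∧ s ^ 2 ≤ a ^ 2 ∧ (τ ≤ a ^ 2 - b ^ 2 → b ^ 2 ≤ s ^ 2) := by
  have hr : 0 < a ^ 2 - b ^ 2 := by nlinarith
  obtain ⟨X, Y, R, hX, hY, hR1, hR2, hYX, hQ, hR0, h0⟩ := h.exists_moduli hb hab
  have hYX' : Y ≤ X := by
    have : 0 ≤ 2 * (-s) * w3 ^ 2 := mul_nonneg (by linarith) (sq_nonneg _)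
    linarith
  have hτ0 : (a - b) ^ 2 ≤ τ := by
    have h1 := (abs_le.1 (h.abs_cross_le hb hab)).2
    have h2 : 0 ≤ -s * (w1 ^ 2 + w2 ^ 2) := mul_nonneg (by linarith) (by positivity)
    rw [h.hτ]
    linarith
  have hτ1 : 0 ≤ τ := (sq_nonneg _).trans hτ0
  refine ⟨hτ0, ?_, ?_⟩
  · rcases hX.eq_or_lt with hX0 | hX0
    · have := h0 hX0.symm (by linarith)
      linarith
    · have : 0 ≤ (a ^ 2 - s ^ 2) * X := by
        nlinarith [mul_le_mul_of_nonneg_left hR2 hr.le, mul_le_mul_of_nonneg_left hYX' hτ1,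
          mul_le_mul_of_nonneg_left hYX' hr.le]
      linarith [nonneg_of_mul_nonneg_left this hX0]
  · intro hτ
    rcases hX.eq_or_lt with hX0 | hX0
    · exact (h0 hX0.symm (by linarith)).ge
    · have : 0 ≤ (s ^ 2 - b ^ 2) * X := by
        nlinarith [mul_le_mul_of_nonneg_left hR1 hr.le,
          mul_le_mul_of_nonneg_left hYX' (sub_nonneg.2 hτ)]
      linarith [nonneg_of_mul_nonneg_left this hX0]

end TiltedEquations

/-! ### The curve 4s²τ + σ = 0, and critical points over every arc. -/

lemma theta_eq_abs {a b s τ : ℝ} (hτ : τ ≠ 0) (h : 4 * s ^ 2 * τ + sigma a b τ = 0) :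
    theta a b τ = |s| := by
  have : 2 * (a ^ 2 + b ^ 2) - (τ ^ 2 + (a ^ 2 - b ^ 2) ^ 2) / τ = (2 * s) ^ 2 := by
    unfold sigma at h
    field_simp
    linear_combination -h
  rw [theta, this, Real.sqrt_sq_eq_abs, abs_mul, abs_two]
  ring

lemma theta_disc {a b τ : ℝ} (hτ : τ ≠ 0)
    (h : 0 ≤ -(τ * sigma a b τ)) : 4 * theta a b τ ^ 2 * τ + sigma a b τ = 0 := by
  have h1 : 2 * (a ^ 2 + b ^ 2) - (τ ^ 2 + (a ^ 2 - b ^ 2) ^ 2) / τ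
      = -(τ * sigma a b τ) / τ ^ 2 := by
    unfold sigma
    field_simp
    ring
  have h2 : 0 ≤ -(τ * sigma a b τ) / τ ^ 2 := by positivity
  rw [theta, h1, mul_pow, Real.sq_sqrt h2]
  field_simp
  ring

variable {a b : ℝ}

lemma fderiv_apply_eq_zero {E : Type*} [NormedAddCommGroup E] [NormedSpace ℝ E]
    {L : E → ℝ} {q v : E} (hL : DifferentiableAt ℝ L q) (C : ℝ)
    (h : ∀ t : ℝ, L (q + t • v) = L q + t ^ 2 * C) : fderiv ℝ L q v = 0 := by
  have h1 := h 1
  have h2 := h (-1)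
  rw [one_smul] at h1
  rw [neg_one_smul, ← sub_eq_add_neg] at h2
  rw [fderiv_apply_of_quadratic hL, h1, h2]
  · ring
  · intro t
    rw [h, h1, h2]
    ring

/-- The values of the integral map on nonregular points. -/
lemma mem_criticalValues (hb : 0 < b) (hab : b < a) {q : State × ℝ} (hq : q ∈ algebraicO a b)
    {G : State × ℝ → ℝ} (hG : ContDiff ℝ ∞ G) (hM : ∀ u ∈ algebraicO a b, G u = 0) {c d : ℝ}
    (hcd : c ≠ 0 ∨ d ≠ 0)
    (h : fderiv ℝ (fun u => G u - c * u.2 - d * integralT u.1) q = 0) :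
    integralMap q ∈ criticalValues a b := by
  rw [criticalValues, completedO_eq hb hab]
  exact ⟨q, ⟨hq, not_isRegularPoint hq hG hM hcd h⟩, rfl⟩

lemma ne_zero_of_sq_eq {x y : ℝ} (hy : 0 < y) (h : x ^ 2 = y ^ 2) : x ≠ 0 := by
  rintro rfl
  have := pow_pos hy 2
  linarith

/-- Here A = 0 or B = 0, with ω₃ = 0. Then d(A × B − (sω₃/2)M)₃, corrected by the differentials of
|α|² and |β|², is a nonzero multiple of ds. The free component of ω moves τ along the line s =
const. -/
lemma mem_criticalValues_of_defect (hb : 0 < b) (hab : b < a) {x y s v w : ℝ} (hx : x ^ 2 = a ^ 2)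
    (hy : y ^ 2 = b ^ 2) (hxy : x = -s ∧ w = 0 ∨ y = -s ∧ v = 0) :
    (s, a ^ 2 + b ^ 2 - 2 * x * y - 2 * s * (v ^ 2 + w ^ 2)) ∈ criticalValues a b := by
  have hx0 : x ≠ 0 := ne_zero_of_sq_eq (hb.trans hab) hx
  have hy0 : y ≠ 0 := ne_zero_of_sq_eq hb hy
  have hq : ((![x, 0, 0], ![0, y, 0], ![v, w, 0]), s) ∈ algebraicO a b := by
    rw [mem_algebraicO_iff]
    rcases hxy with ⟨rfl, rfl⟩ | ⟨rfl, rfl⟩ <;> simp <;> constructor <;> linarith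
  have hF : integralMap ((![x, 0, 0], ![0, y, 0], ![v, w, 0]), s) =
      (s, a ^ 2 + b ^ 2 - 2 * x * y - 2 * s * (v ^ 2 + w ^ 2)) := by
    rw [integralMap, integralT_of_mem hq]
    simp
    ring
  rw [← hF]
  obtain ⟨P1, hP1⟩ : ∃ P1, y + s + 2 * P1 * x = 0 := ⟨-(y + s) / (2 * x), by field_simp; ring⟩
  obtain ⟨P2, hP2⟩ : ∃ P2, x + s + 2 * P2 * y = 0 := ⟨-(x + s) / (2 * y), by field_simp; ring⟩
  -- Vanishing would give x = y = −s, hence a² = b².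
  have hc : x + y + 2 * s ≠ 0 := by
    intro h0
    have hxy' : x = y := by rcases hxy with ⟨h, -⟩ | ⟨h, -⟩ <;> linarith
    rw [hxy', hy] at hx
    nlinarith
  have hG : ContDiff ℝ ∞ fun u : State × ℝ => defect u 2
      + P1 * (u.1.1 0 ^ 2 + u.1.1 1 ^ 2 + u.1.1 2 ^ 2 - a ^ 2)
      + P2 * (u.1.2.1 0 ^ 2 + u.1.2.1 1 ^ 2 + u.1.2.1 2 ^ 2 - b ^ 2) := by
    simp only [defect, Matrix.cons_val]
    fun_prop
  refine mem_criticalValues hb hab hq hG ?_ (c := x + y + 2 * s) (d := 0) (Or.inl hc) ?_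
  · rintro u ⟨hp, -, -, hd⟩
    rw [mem_phaseSpace_iff] at hp
    rw [hp.1, hp.2.1, hd]
    simp
  · have hL : Differentiable ℝ fun u : State × ℝ => (defect u 2
      + P1 * (u.1.1 0 ^ 2 + u.1.1 1 ^ 2 + u.1.1 2 ^ 2 - a ^ 2)
      + P2 * (u.1.2.1 0 ^ 2 + u.1.2.1 1 ^ 2 + u.1.2.1 2 ^ 2 - b ^ 2))
      - (x + y + 2 * s) * u.2 - 0 * integralT u.1 :=
      ((hG.differentiable (by simp)).sub (differentiable_snd.const_mul _)).sub
        ((contDiff_integralT.differentiable (by simp)).const_mul _)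
    apply clm_eq_zero_of_dir
    · intro i
      refine fderiv_apply_eq_zero (hL _) P1 fun t => ?_
      fin_cases i <;> simp [-Matrix.add_cons, -Matrix.cons_add, dirα, defect]
      · linear_combination t * hP1
      · ring
      · ring
    · intro i
      refine fderiv_apply_eq_zero (hL _) P2 fun t => ?_
      fin_cases i <;> simp [-Matrix.add_cons, -Matrix.cons_add, dirβ, defect]
      · ring
      · linear_combination t * hP2
      · ring
    · intro i
      refine fderiv_apply_eq_zero (hL _) (if i = 2 then -s / 2 else 0) fun t => ?_
      fin_cases i <;> simp [-Matrix.add_cons, -Matrix.cons_add, dirω, defect]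
      ring
    · refine fderiv_apply_eq_zero (hL _) 1 fun t => ?_
      simp [-Matrix.add_cons, -Matrix.cons_add, dirS, defect]
      ring

/-- Existence of points of the variety over configurations with `α₂ = 0` and `β` along the second
axis. -/
lemma exists_mem_algebraicO {x z y s : ℝ} (hx : x ^ 2 + z ^ 2 = a ^ 2) (hy : y ^ 2 = b ^ 2)
    (h : 0 < (x + s) * (y + s) / s) :
    ∃ v r : ℝ, ((![x, 0, z], ![0, y, 0], ![v, 0, r]), s) ∈ algebraicO a b := by
  have hs : s ≠ 0 := by
    rintro rfl
    simp at h
  have hr : 0 < 2 * ((x + s) * (y + s) / s) := by positivity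
  have hr0 := (Real.sqrt_pos.2 hr).ne'
  have hr2 := Real.sq_sqrt hr.le
  set r := Real.sqrt (2 * ((x + s) * (y + s) / s))
  -- The values of ω₃ and ω₁ are read off from the third and first components of A × B = (sω₃/2)M.
  refine ⟨-z * (y + s) / (s * r), r, ?_⟩
  rw [mem_algebraicO_iff]
  have hr2' : s * r ^ 2 = 2 * ((x + s) * (y + s)) := by
    rw [hr2]; field_simp
  refine ⟨⟨?_, ?_, ?_⟩, ?_, ?_, ?_, ?_, ?_⟩ <;> simp
  · exact hx
  · exact hy
  · field_simp
    linear_combination z * hr2'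
  · field_simp
  · linear_combination -hr2' / 2

lemma integralT_relation {x z y s v r : ℝ}
    (h : ((![x, 0, z], ![0, y, 0], ![v, 0, r]), s) ∈ algebraicO a b) :
    integralT (![x, 0, z], ![0, y, 0], ![v, 0, r]) * (4 * ((x + s) * (y + s))) =
      2 * (a ^ 2 - b ^ 2) * (x - y) * (x + y + 2 * s)
        + (4 * s ^ 2 - 2 * (a ^ 2 + b ^ 2)) * (x - y) ^ 2 := by
  have := (tiltedEquations_of_mem h).quadratic_relation
  simp at this
  linear_combination this

/-- The polynomial `4 τ (A × B)₃ - (4s² - 2p²) |x₁|² - 2r² Re (x̄₁ (y₁ + 2s))`. -/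
def relationAt (a b τ : ℝ) (u : State × ℝ) : ℝ :=
  4 * τ * ((u.1.1 0 + u.2) * (u.1.2.1 1 + u.2) - u.1.1 1 * u.1.2.1 0)
    - (4 * u.2 ^ 2 - 2 * (a ^ 2 + b ^ 2))
      * ((u.1.1 0 - u.1.2.1 1) ^ 2 + (u.1.1 1 + u.1.2.1 0) ^ 2)
    - 2 * (a ^ 2 - b ^ 2) * (u.1.1 0 ^ 2 + u.1.1 1 ^ 2 - u.1.2.1 0 ^ 2 - u.1.2.1 1 ^ 2
      + 2 * u.2 * (u.1.1 0 - u.1.2.1 1))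

lemma relationAt_eq_zero {u : State × ℝ} (hu : u ∈ algebraicO a b) :
    relationAt a b (integralT u.1) u = 0 := by
  obtain ⟨⟨α, β, w⟩, s⟩ := u
  have := (tiltedEquations_of_mem hu).quadratic_relation
  simp only [relationAt]
  linear_combination this

/-- The derivative of `relationAt` in the direction `α₁`, at the configurations of
`exists_mem_algebraicO`. -/
def relationSlope (a b τ x y s : ℝ) : ℝ :=
  4 * τ * (y + s) - 2 * (4 * s ^ 2 - 2 * (a ^ 2 + b ^ 2)) * (x - y) - 4 * (a ^ 2 - b ^ 2) * (x + s)

/-- The hermitian relation with τ replaced by T vanishes on the variety, and its T-derivative is 4(A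
× B)₃ ≠ 0. Its differential at fixed τ reduces to a multiple of ds modulo d|α|² and d|β|²; the
α₁-slope can be absorbed by d|α|² only if z = 0, and otherwise must vanish. -/
lemma mem_criticalValues_of_relation (hb : 0 < b) (hab : b < a) {x z y s v r τ : ℝ}
    (h : ((![x, 0, z], ![0, y, 0], ![v, 0, r]), s) ∈ algebraicO a b)
    (hn : (x + s) * (y + s) ≠ 0)
    (hτ : integralT (![x, 0, z], ![0, y, 0], ![v, 0, r]) = τ)
    (hz : z = 0 ∨ relationSlope a b τ x y s = 0) : (s, τ) ∈ criticalValues a b := by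
  have h' := h
  rw [mem_algebraicO_iff] at h'
  obtain ⟨⟨p1, p2, -⟩, -⟩ := h'
  simp at p1 p2
  have hy0 : y ≠ 0 := ne_zero_of_sq_eq hb p2
  obtain ⟨P1, hP1, hP1'⟩ : ∃ P1, relationSlope a b τ x y s + 2 * P1 * x = 0 ∧ P1 * z = 0 := by
    rcases hz with rfl | hz
    · have hx0 : x ≠ 0 := ne_zero_of_sq_eq (hb.trans hab) (by linear_combination p1)
      refine ⟨-relationSlope a b τ x y s / (2 * x), ?_, mul_zero _⟩
      field_simp
      ring
    · exact ⟨0, by rw [hz]; ring, zero_mul _⟩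
  obtain ⟨P2, hP2⟩ : ∃ P2, 4 * τ * (x + s) + 2 * (4 * s ^ 2 - 2 * (a ^ 2 + b ^ 2)) * (x - y)
      + 4 * (a ^ 2 - b ^ 2) * (y + s) + 2 * P2 * y = 0 :=
    ⟨-(4 * τ * (x + s) + 2 * (4 * s ^ 2 - 2 * (a ^ 2 + b ^ 2)) * (x - y)
      + 4 * (a ^ 2 - b ^ 2) * (y + s)) / (2 * y), by field_simp; ring⟩
  set c := 4 * τ * (x + y + 2 * s) - 8 * s * (x - y) ^ 2 - 4 * (a ^ 2 - b ^ 2) * (x - y) with hc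
  have hF : integralMap ((![x, 0, z], ![0, y, 0], ![v, 0, r]), s) = (s, τ) := by
    rw [integralMap, hτ]
  rw [← hF]
  set q : State × ℝ := ((![x, 0, z], ![0, y, 0], ![v, 0, r]), s) with hq
  have hT := contDiff_integralT
  have hG : ContDiff ℝ ∞ fun u : State × ℝ => relationAt a b (integralT u.1) u
      + P1 * (u.1.1 0 ^ 2 + u.1.1 1 ^ 2 + u.1.1 2 ^ 2 - a ^ 2)
      + P2 * (u.1.2.1 0 ^ 2 + u.1.2.1 1 ^ 2 + u.1.2.1 2 ^ 2 - b ^ 2) := by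
    unfold relationAt
    fun_prop
  refine mem_criticalValues hb hab h hG ?_ (c := c) (d := 4 * ((x + s) * (y + s)))
    (Or.inr (mul_ne_zero four_ne_zero hn)) ?_
  · rintro u hu
    have hp := mem_phaseSpace_iff.1 hu.1
    rw [relationAt_eq_zero hu, hp.1, hp.2.1]
    simp
  set K : State × ℝ → ℝ := fun u => relationAt a b τ u
      + P1 * (u.1.1 0 ^ 2 + u.1.1 1 ^ 2 + u.1.1 2 ^ 2 - a ^ 2)
      + P2 * (u.1.2.1 0 ^ 2 + u.1.2.1 1 ^ 2 + u.1.2.1 2 ^ 2 - b ^ 2) - c * u.2 with hK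
  have hKd : Differentiable ℝ K := by
    simp only [hK, relationAt]
    fun_prop
  have hK0 : fderiv ℝ K q = 0 := by
    apply clm_eq_zero_of_dir
    · intro i
      refine fderiv_apply_eq_zero (hKd _) (P1 + if i = 2 then 0 else
        -(4 * s ^ 2 - 2 * (a ^ 2 + b ^ 2)) - 2 * (a ^ 2 - b ^ 2)) fun t => ?_
      unfold relationSlope at hP1
      fin_cases i <;> simp [-Matrix.add_cons, -Matrix.cons_add, dirα, hK, hq, relationAt]
      · linear_combination t * hP1
      · ring
      · linear_combination 2 * t * hP1'
    · intro i
      refine fderiv_apply_eq_zero (hKd _) (P2 + if i = 2 then 0 else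
        -(4 * s ^ 2 - 2 * (a ^ 2 + b ^ 2)) + 2 * (a ^ 2 - b ^ 2)) fun t => ?_
      fin_cases i <;> simp [-Matrix.add_cons, -Matrix.cons_add, dirβ, hK, hq, relationAt]
      · ring
      · linear_combination t * hP2
      · ring
    · intro i
      refine fderiv_apply_eq_zero (hKd _) 0 fun t => ?_
      fin_cases i <;> simp [-Matrix.add_cons, -Matrix.cons_add, dirω, hK, hq, relationAt]
    · refine fderiv_apply_eq_zero (hKd _) (4 * τ - 4 * (x - y) ^ 2) fun t => ?_
      simp [-Matrix.add_cons, -Matrix.cons_add, dirS, hK, hq, relationAt, hc]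
      ring
  -- Both factors vanish at q. This product is the second-order error of replacing T by τ and (A ×
  -- B)₃ by its value at q.
  have hprod : HasFDerivAt (fun u : State × ℝ => (integralT u.1 - τ)
      * (4 * ((u.1.1 0 + u.2) * (u.1.2.1 1 + u.2) - u.1.1 1 * u.1.2.1 0)
        - 4 * ((x + s) * (y + s)))) (0 : State × ℝ →L[ℝ] ℝ) q := by
    have h1 : DifferentiableAt ℝ (fun u : State × ℝ => integralT u.1 - τ) q :=
      (hT.differentiable (by simp) q).sub_const τ
    have h2 : DifferentiableAt ℝ (fun u : State × ℝ =>
        4 * ((u.1.1 0 + u.2) * (u.1.2.1 1 + u.2) - u.1.1 1 * u.1.2.1 0)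
        - 4 * ((x + s) * (y + s))) q := by fun_prop
    have h3 := h1.hasFDerivAt.mul h2.hasFDerivAt
    refine h3.congr_fderiv ?_
    simp [hq, hτ]
  have hKq : HasFDerivAt K (fderiv ℝ K q) q := (hKd q).hasFDerivAt
  have hsum := ((hKq.add hprod).sub_const (4 * ((x + s) * (y + s)) * τ)).fderiv
  rw [hK0, add_zero] at hsum
  rw [← hsum]
  congr 1
  funext u
  simp only [hK, relationAt, Pi.add_apply]
  ring

lemma mem_criticalValues_a (hb : 0 < b) (hab : b < a) {τ : ℝ} (hτ : τ ≤ (a + b) ^ 2) :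
    (a, τ) ∈ criticalValues a b := by
  have ha := hb.trans hab
  have h := mem_criticalValues_of_defect hb hab (x := -a) (y := b) (s := a) (w := 0)
    (v := Real.sqrt (((a + b) ^ 2 - τ) / (2 * a))) (by ring) rfl (Or.inl ⟨rfl, rfl⟩)
  rw [Real.sq_sqrt (div_nonneg (by linarith) (by linarith))] at h
  convert h using 2
  field_simp
  ring

lemma mem_criticalValues_neg_a (hb : 0 < b) (hab : b < a) {τ : ℝ} (hτ : (a - b) ^ 2 ≤ τ) :
    (-a, τ) ∈ criticalValues a b := by
  have ha := hb.trans hab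
  have h := mem_criticalValues_of_defect hb hab (x := a) (y := b) (s := -a) (w := 0)
    (v := Real.sqrt ((τ - (a - b) ^ 2) / (2 * a))) rfl rfl (Or.inl ⟨by ring, rfl⟩)
  rw [Real.sq_sqrt (div_nonneg (by linarith) (by linarith))] at h
  convert h using 2
  field_simp
  ring

lemma mem_criticalValues_b (hb : 0 < b) (hab : b < a) {τ : ℝ} (hτ : τ ≤ (a + b) ^ 2) :
    (b, τ) ∈ criticalValues a b := by
  have h := mem_criticalValues_of_defect hb hab (x := a) (y := -b) (s := b) (v := 0)
    (w := Real.sqrt (((a + b) ^ 2 - τ) / (2 * b))) rfl (by ring) (Or.inr ⟨rfl, rfl⟩)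
  rw [Real.sq_sqrt (div_nonneg (by linarith) (by linarith))] at h
  convert h using 2
  field_simp
  ring

lemma mem_criticalValues_neg_b (hb : 0 < b) (hab : b < a) {τ : ℝ} (hτ : (a - b) ^ 2 ≤ τ) :
    (-b, τ) ∈ criticalValues a b := by
  have h := mem_criticalValues_of_defect hb hab (x := a) (y := b) (s := -b) (v := 0)
    (w := Real.sqrt ((τ - (a - b) ^ 2) / (2 * b))) rfl rfl (Or.inr ⟨by ring, rfl⟩)
  rw [Real.sq_sqrt (div_nonneg (by linarith) (by linarith))] at h
  convert h using 2
  field_simp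
  ring

lemma mem_criticalValues_sq_sub (hb : 0 < b) (hab : b < a) {y s : ℝ} (hy : y ^ 2 = b ^ 2)
    (h : 0 < (a + s) * (y + s) / s) : (s, (a - y) ^ 2) ∈ criticalValues a b := by
  obtain ⟨v, r, hq⟩ := exists_mem_algebraicO (a := a) (x := a) (z := 0) (by ring) hy h
  have hn : (a + s) * (y + s) ≠ 0 := by
    intro h0
    simp [h0] at h
  refine mem_criticalValues_of_relation hb hab hq hn ?_ (Or.inl rfl)
  have hT := integralT_relation hq
  rw [← hy] at hT
  apply mul_right_cancel₀ (mul_ne_zero four_ne_zero hn)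
  rw [hT]
  ring

/-- When the determinant is zero, the hermitian form has the null direction τY = r²X. Taking x + s
and y + s proportional to r² + τ and r² − τ realises it, and the slope becomes a multiple of the
determinant. The two inequalities ensure ω₃² > 0 and x² ≤ a². -/
lemma mem_criticalValues_of_disc (hb : 0 < b) (hab : b < a) {y s τ : ℝ} (hy : y ^ 2 = b ^ 2)
    (hdisc : 4 * s ^ 2 * τ + sigma a b τ = 0) (hys : y + s ≠ 0)
    (hsign : 0 < (a ^ 2 - b ^ 2 + τ) / ((a ^ 2 - b ^ 2 - τ) * s))
    (hbd : 0 ≤ (a ^ 2 - b ^ 2 + τ) * (sigma a b τ - 4 * (y * s * τ))) :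
    (s, τ) ∈ criticalValues a b := by
  have hd : (a ^ 2 - b ^ 2 - τ) ≠ 0 := by
    intro h0
    simp [h0] at hsign
  have hs : s ≠ 0 := by
    rintro rfl
    simp at hsign
  obtain ⟨e, he⟩ : ∃ e, y + s = e * (a ^ 2 - b ^ 2 - τ) :=
    ⟨(y + s) / (a ^ 2 - b ^ 2 - τ), by field_simp⟩
  set x := e * (a ^ 2 - b ^ 2 + τ) - s with hx
  have hxs : x + s = e * (a ^ 2 - b ^ 2 + τ) := by rw [hx]; ring
  have hxy : x - y = 2 * τ * e := by linear_combination hxs - he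
  have hz : 0 ≤ a ^ 2 - x ^ 2 := by
    have h1 : (a ^ 2 - b ^ 2 - τ) ^ 2 * (a ^ 2 - x ^ 2)
        = (a ^ 2 - b ^ 2 + τ) * (sigma a b τ - 4 * (y * s * τ)) := by
      have h2 : (a ^ 2 - b ^ 2 - τ) * x = y * (a ^ 2 - b ^ 2 + τ) + 2 * s * τ := by
        rw [hx]
        linear_combination -(a ^ 2 - b ^ 2 + τ) * he
      unfold sigma at hdisc ⊢
      linear_combination (-(a ^ 2 - b ^ 2 - τ) * x - (y * (a ^ 2 - b ^ 2 + τ) + 2 * s * τ)) * h2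
        - (a ^ 2 - b ^ 2 + τ) ^ 2 * hy - τ * hdisc
    rw [← h1] at hbd
    exact nonneg_of_mul_nonneg_right hbd (by positivity)
  have he0 : e ≠ 0 := by
    rintro rfl
    exact hys (by rw [he, zero_mul])
  have hpos : 0 < (x + s) * (y + s) / s := by
    have : (x + s) * (y + s) / s = (e * (a ^ 2 - b ^ 2 - τ)) ^ 2
        * ((a ^ 2 - b ^ 2 + τ) / ((a ^ 2 - b ^ 2 - τ) * s)) := by
      rw [hxs, he]
      field_simp
    rw [this]
    positivity
  obtain ⟨v, r, hq⟩ := exists_mem_algebraicO (a := a) (x := x) (z := Real.sqrt (a ^ 2 - x ^ 2))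
    (by rw [Real.sq_sqrt hz]; ring) hy hpos
  have hn : (x + s) * (y + s) ≠ 0 := by
    intro h0
    simp [h0] at hpos
  unfold sigma at hdisc
  refine mem_criticalValues_of_relation hb hab hq hn ?_ (Or.inr ?_)
  · apply mul_right_cancel₀ (mul_ne_zero four_ne_zero hn)
    rw [integralT_relation hq, show x + y + 2 * s = (x + s) + (y + s) by ring, hxy, hxs, he]
    linear_combination 4 * τ * e ^ 2 * hdisc
  · rw [relationSlope, hxy, hxs, he]
    linear_combination -4 * e * hdisc

lemma mem_admissibleSet_zero (hb : 0 < b) (hab : b < a) {s : ℝ} (hs : 0 < s) :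
    (s, 0) ∈ admissibleSet a b := by
  -- Choosing x = y = b makes x₁ = 0, so the hermitian relation reads τ|Y|² = 0 with Y ≠ 0.
  have hpos : 0 < (b + s) * (b + s) / s := by positivity
  have hz : 0 ≤ a ^ 2 - b ^ 2 := by nlinarith
  obtain ⟨v, r, hq⟩ := exists_mem_algebraicO (a := a) (x := b) (y := b) (z := Real.sqrt (a ^ 2 - b ^ 2))
    (by rw [Real.sq_sqrt hz]; ring) rfl hpos
  have hT := integralT_relation hq
  rw [sub_self] at hT
  refine ⟨_, by rwa [completedO_eq hb hab], ?_⟩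
  rw [integralMap, Prod.mk.injEq]
  refine ⟨rfl, ?_⟩
  have hn : 4 * ((b + s) * (b + s)) ≠ 0 := by positivity
  apply mul_right_cancel₀ hn
  rw [hT]
  ring

lemma theta_nonneg (a b τ : ℝ) : 0 ≤ theta a b τ := by
  unfold theta
  positivity

lemma theta_pos_of_mul_neg {τ : ℝ} (h : τ * sigma a b τ < 0) : 0 < theta a b τ := by
  have hτ : τ ≠ 0 := left_ne_zero_of_mul h.ne
  refine (theta_nonneg a b τ).lt_of_ne' fun h0 => h.ne ?_
  have := theta_disc hτ (by linarith : 0 ≤ -(τ * sigma a b τ))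
  rw [h0] at this
  linear_combination τ * this

/-- At s² = b² the expression 4s²τ + σ equals (τ − r²)². -/
lemma add_theta_ne_zero {y τ : ℝ} (hy : y ^ 2 = b ^ 2) (h : τ * sigma a b τ < 0)
    (hτ' : a ^ 2 - b ^ 2 ≠ τ) {s : ℝ} (hs : s ^ 2 = theta a b τ ^ 2) : y + s ≠ 0 := by
  intro h0
  have hτ : τ ≠ 0 := left_ne_zero_of_mul h.ne
  have hd := theta_disc hτ (by linarith : 0 ≤ -(τ * sigma a b τ))
  rw [← hs] at hd
  apply pow_ne_zero 2 (sub_ne_zero.2 hτ')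
  unfold sigma at hd
  linear_combination hd - 4 * τ * hy + 4 * τ * (y - s) * h0

/-- Squaring, and using 4θ²τ = −σ, reduces the claim to σ + 4b²τ = (τ − r²)² ≥ 0. -/
lemma sigma_add_theta_nonneg (hb : 0 < b) {τ : ℝ} (hτ : 0 < τ) (hσ : sigma a b τ < 0) :
    0 ≤ sigma a b τ + 4 * (b * theta a b τ * τ) := by
  have hd := theta_disc hτ.ne' (by nlinarith : 0 ≤ -(τ * sigma a b τ))
  have h0 := theta_nonneg a b τ
  have h1 : 0 ≤ sigma a b τ + 4 * b ^ 2 * τ := by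
    unfold sigma
    nlinarith [sq_nonneg (τ - (a ^ 2 - b ^ 2))]
  have h2 : (-sigma a b τ) ^ 2 ≤ (4 * (b * theta a b τ * τ)) ^ 2 := by
    have : (4 * (b * theta a b τ * τ)) ^ 2 - (-sigma a b τ) ^ 2
        = -sigma a b τ * (sigma a b τ + 4 * b ^ 2 * τ) := by
      linear_combination 4 * b ^ 2 * τ * hd
    have h3 : 0 ≤ -sigma a b τ * (sigma a b τ + 4 * b ^ 2 * τ) :=
      mul_nonneg (by linarith) h1
    linarith
  have := abs_le_of_sq_le_sq h2 (by positivity)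
  linarith [neg_abs_le (-sigma a b τ), le_abs_self (-sigma a b τ)]

lemma sigma_neg {τ : ℝ} (h1 : (a - b) ^ 2 < τ) (h2 : τ < (a + b) ^ 2) :
    sigma a b τ < 0 := by
  rw [sigma_eq]
  exact mul_neg_of_pos_of_neg (by linarith) (by linarith)

lemma mem_criticalValues_neg_theta (hb : 0 < b) (hab : b < a) {τ : ℝ}
    (h1 : a ^ 2 - b ^ 2 < τ) (h2 : τ < (a + b) ^ 2) :
    (-theta a b τ, τ) ∈ criticalValues a b := by
  have hr : 0 < a ^ 2 - b ^ 2 := by nlinarith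
  have hσ := sigma_neg (by nlinarith) h2
  have hτ : 0 < τ := by linarith
  have hm := mul_neg_of_pos_of_neg hτ hσ
  have hd := theta_disc hτ.ne' (by linarith : 0 ≤ -(τ * sigma a b τ))
  have hθ := theta_pos_of_mul_neg hm
  refine mem_criticalValues_of_disc hb hab (y := b) rfl (by linear_combination hd)
    (add_theta_ne_zero rfl hm h1.ne (by ring)) ?_ ?_
  · exact div_pos (by linarith) (mul_pos_of_neg_of_neg (by linarith) (by linarith))
  · refine mul_nonneg (by linarith) ?_
    have := sigma_add_theta_nonneg hb hτ hσ
    linarith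

lemma mem_criticalValues_theta_of_neg (hb : 0 < b) (hab : b < a) {τ : ℝ}
    (h1 : -(a ^ 2 - b ^ 2) < τ) (h2 : τ < 0) :
    (theta a b τ, τ) ∈ criticalValues a b := by
  have hr : 0 < a ^ 2 - b ^ 2 := by nlinarith
  have hσ : 0 < sigma a b τ := by
    unfold sigma
    nlinarith [sq_nonneg τ, sq_nonneg (a ^ 2 - b ^ 2), mul_nonneg (sq_nonneg a) (neg_pos.2 h2).le,
      mul_nonneg (sq_nonneg b) (neg_pos.2 h2).le]
  have hm := mul_neg_of_neg_of_pos h2 hσ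
  have hd := theta_disc h2.ne (by linarith : 0 ≤ -(τ * sigma a b τ))
  have hθ := theta_pos_of_mul_neg hm
  refine mem_criticalValues_of_disc hb hab (y := b) rfl hd
    (add_theta_ne_zero rfl hm (by linarith) rfl) ?_ ?_
  · exact div_pos (by linarith) (mul_pos (by linarith) hθ)
  · refine mul_nonneg (by linarith) ?_
    have := mul_neg_of_pos_of_neg (mul_pos hb hθ) h2
    linarith

lemma mem_criticalValues_theta_of_pos (hb : 0 < b) (hab : b < a) {τ : ℝ}
    (h1 : (a - b) ^ 2 < τ) (h2 : τ < a ^ 2 - b ^ 2) :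
    (theta a b τ, τ) ∈ criticalValues a b := by
  have hτ : 0 < τ := (sq_nonneg _).trans_lt h1
  have hσ := sigma_neg h1 (by nlinarith)
  have hm := mul_neg_of_pos_of_neg hτ hσ
  have hd := theta_disc hτ.ne' (by linarith : 0 ≤ -(τ * sigma a b τ))
  have hθ := theta_pos_of_mul_neg hm
  -- Since σ < 0 < τ, the bound x² ≤ a² is obtained by giving y and s opposite signs.
  refine mem_criticalValues_of_disc hb hab (y := -b) (by ring) hd
    (add_theta_ne_zero (by ring) hm h2.ne' rfl) ?_ ?_
  · exact div_pos (by linarith) (mul_pos (by linarith) hθ)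
  · refine mul_nonneg (by linarith) ?_
    have := sigma_add_theta_nonneg hb hτ hσ
    linarith

/-! ### Comparison of the diagram with the arcs. -/

/-- The union of the arcs of the bifurcation diagram off the axis `τ = 0`. -/
def criticalArcs (a b : ℝ) : Set (ℝ × ℝ) :=
  {f | (f.2 = (a - b) ^ 2 ∧ f.1 ∈ Set.Icc (-a) (-b) ∪ Set.Ioi 0) ∨
    (f.2 = (a + b) ^ 2 ∧ f.1 ∈ Set.Ico (-a) 0 ∪ Set.Ioi b) ∨
    (f.1 = -a ∧ f.2 ∈ Set.Ici ((a - b) ^ 2)) ∨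
    (f.1 = -b ∧ f.2 ∈ Set.Ici ((a - b) ^ 2)) ∨
    (f.1 = -theta a b f.2 ∧ f.2 ∈ Set.Ioo (a ^ 2 - b ^ 2) ((a + b) ^ 2)) ∨
    (f.1 = theta a b f.2 ∧
      f.2 ∈ Set.Ioo (-(a ^ 2 - b ^ 2)) 0 ∪ Set.Ioo ((a - b) ^ 2) (a ^ 2 - b ^ 2)) ∨
    (f.1 = b ∧ f.2 ∈ Set.Iic ((a + b) ^ 2)) ∨
    (f.1 = a ∧ f.2 ∈ Set.Iic ((a + b) ^ 2))}

lemma criticalArcs_subset (hb : 0 < b) (hab : b < a) : criticalArcs a b ⊆ criticalValues a b := by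
  rintro ⟨s, τ⟩ h
  have ha := hb.trans hab
  simp only [criticalArcs, Set.mem_ofPred_eq, Set.mem_union, Set.mem_Icc, Set.mem_Ioi, Set.mem_Ico,
    Set.mem_Ici, Set.mem_Ioo, Set.mem_Iic] at h
  rcases h with ⟨rfl, ⟨h1, h2⟩ | h⟩ | ⟨rfl, ⟨h1, h2⟩ | h⟩ | ⟨rfl, h⟩ | ⟨rfl, h⟩ | ⟨rfl, h1, h2⟩ |
    ⟨rfl, ⟨h1, h2⟩ | ⟨h1, h2⟩⟩ | ⟨rfl, h⟩ | ⟨rfl, h⟩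
  · rcases h1.eq_or_lt with rfl | h1
    · exact mem_criticalValues_neg_a hb hab le_rfl
    rcases h2.eq_or_lt with rfl | h2
    · exact mem_criticalValues_neg_b hb hab le_rfl
    exact mem_criticalValues_sq_sub hb hab rfl
      (div_pos_of_neg_of_neg (mul_neg_of_pos_of_neg (by linarith) (by linarith)) (by linarith))
  · exact mem_criticalValues_sq_sub hb hab rfl (by positivity)
  · rcases h1.eq_or_lt with rfl | h1
    · exact mem_criticalValues_neg_a hb hab (by nlinarith)
    have := mem_criticalValues_sq_sub hb hab (y := -b) (s := s) (by ring)
      (div_pos_of_neg_of_neg (mul_neg_of_pos_of_neg (by linarith) (by linarith)) (by linarith))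
    rwa [sub_neg_eq_add] at this
  · have := mem_criticalValues_sq_sub hb hab (y := -b) (s := s) (by ring)
      (div_pos (mul_pos (by linarith) (by linarith)) (by linarith))
    rwa [sub_neg_eq_add] at this
  · exact mem_criticalValues_neg_a hb hab h
  · exact mem_criticalValues_neg_b hb hab h
  · exact mem_criticalValues_neg_theta hb hab h1 h2
  · exact mem_criticalValues_theta_of_neg hb hab h1 h2
  · exact mem_criticalValues_theta_of_pos hb hab h1 h2
  · exact mem_criticalValues_b hb hab h
  · exact mem_criticalValues_a hb hab h

lemma criticalValues_subset_diagram (hb : 0 < b) (hab : b < a) :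
    criticalValues a b ⊆ bifurcationDiagram a b ∩ {f | f.2 = 0 → f.1 = a ∨ f.1 = b} := by
  rintro _ ⟨q, ⟨hq, hcrit⟩, rfl⟩
  obtain ⟨⟨α, β, w⟩, s⟩ := q
  have hsep : s ^ 2 = a ^ 2 ∨ s ^ 2 = b ^ 2 ∨ sigma a b (integralT (α, β, w)) = 0 ∨
      4 * s ^ 2 * integralT (α, β, w) + sigma a b (integralT (α, β, w)) = 0 := by
    by_contra! h
    exact hcrit (isRegularPoint_of_mem hb hab hq h.1 h.2.1 h.2.2.1 h.2.2.2)
  refine ⟨⟨⟨_, hq, rfl⟩, (mem_separatingSet_iff hb hab).2 (by tauto)⟩, fun h0 => ?_⟩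
  change integralT (α, β, w) = 0 at h0
  have hr : 0 < a ^ 2 - b ^ 2 := by nlinarith
  rw [completedO_eq hb hab] at hq
  have hT := tiltedEquations_of_mem hq
  have hs0 : s ≠ 0 := ne_zero_of_mem hb hab hq
  rw [h0] at hsep hT
  have hs : 0 < s := by
    by_contra! hs
    have := (hT.bounds_of_neg hb hab (lt_of_le_of_ne hs hs0)).1
    have : 0 < (a - b) ^ 2 := pow_pos (sub_pos.2 hab) 2
    linarith
  have hσ : sigma a b 0 ≠ 0 := by
    have : sigma a b 0 = (a ^ 2 - b ^ 2) ^ 2 := by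
      unfold sigma
      ring
    rw [this]
    positivity
  rcases hsep with h | h | h | h
  · exact Or.inl ((sq_eq_sq₀ hs.le (hb.trans hab).le).1 h)
  · exact Or.inr ((sq_eq_sq₀ hs.le hb.le).1 h)
  · exact absurd h hσ
  · exact absurd (by linarith) hσ

lemma mem_criticalArcs_of_neg (hb : 0 < b) (hab : b < a) {s τ A1 A2 A3 B1 B2 B3 w1 w2 w3 : ℝ}
    (hT : TiltedEquations a b s τ A1 A2 A3 B1 B2 B3 w1 w2 w3) (hs : s < 0)
    (hsep : sigma a b τ = 0 ∨ 4 * s ^ 2 * τ + sigma a b τ = 0 ∨ s ^ 2 = a ^ 2 ∨ s ^ 2 = b ^ 2) :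
    (s, τ) ∈ criticalArcs a b := by
  have ha := hb.trans hab
  have hab2 : 0 < (a - b) ^ 2 := pow_pos (sub_pos.2 hab) 2
  obtain ⟨b1, b2, b3⟩ := hT.bounds_of_neg hb hab hs
  have hτ := hab2.trans_le b1
  have hsa : -a ≤ s := (abs_le_of_sq_le_sq' b2 ha.le).1
  have hsb : τ ≤ a ^ 2 - b ^ 2 → s ≤ -b := fun h => by nlinarith [b3 h]
  have hs2 : 0 < s ^ 2 := sq_pos_iff.2 hs.ne
  rcases hsep with h | h | h | h
  · rw [sigma_eq, mul_eq_zero, sub_eq_zero, sub_eq_zero] at h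
    rcases h with h | h
    · exact .inl ⟨h, .inl ⟨hsa, hsb (by nlinarith)⟩⟩
    · exact .inr (.inl ⟨h, .inl ⟨hsa, hs⟩⟩)
  · rcases lt_or_ge (a ^ 2 - b ^ 2) τ with h1 | h1
    · have hθ := theta_eq_abs hτ.ne' h
      rw [abs_of_neg hs] at hθ
      have h2 : τ < (a + b) ^ 2 := by
        rw [sigma_eq] at h
        nlinarith [mul_pos hs2 hτ]
      exact .inr (.inr (.inr (.inr (.inl ⟨by simp [hθ], h1, h2⟩))))
    -- On the curve, 4τ(b² − s²) = (r² − τ)² ≥ 0; with the opposite bound s² ≥ b² this part of the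
    -- curve shrinks to its tangency with s = −b.
    · have h2 : s = -b := by
        have h3 : 4 * τ * (b ^ 2 - s ^ 2) = (a ^ 2 - b ^ 2 - τ) ^ 2 := by
          unfold sigma at h
          linear_combination -h
        have h4 : 0 ≤ b ^ 2 - s ^ 2 :=
          nonneg_of_mul_nonneg_right (h3 ▸ sq_nonneg _) (by linarith)
        exact le_antisymm (hsb h1) (abs_le_of_sq_le_sq' (sub_nonneg.1 h4) hb.le).1
      exact .inr (.inr (.inr (.inl ⟨h2, b1⟩)))
  · have h2 : s = -a := (sq_eq_sq_iff_eq_or_eq_neg.1 h).resolve_left (by linarith)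
    exact .inr (.inr (.inl ⟨h2, b1⟩))
  · have h2 : s = -b := (sq_eq_sq_iff_eq_or_eq_neg.1 h).resolve_left (by linarith)
    exact .inr (.inr (.inr (.inl ⟨h2, b1⟩)))

lemma mem_criticalArcs_of_pos (hb : 0 < b) (hab : b < a) {s τ A1 A2 A3 B1 B2 B3 w1 w2 w3 : ℝ}
    (hT : TiltedEquations a b s τ A1 A2 A3 B1 B2 B3 w1 w2 w3) (hs : 0 < s) (hτ : τ ≠ 0)
    (hsep : sigma a b τ = 0 ∨ 4 * s ^ 2 * τ + sigma a b τ = 0 ∨ s ^ 2 = a ^ 2 ∨ s ^ 2 = b ^ 2) :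
    (s, τ) ∈ criticalArcs a b := by
  have ha := hb.trans hab
  obtain ⟨b1, b2, b3⟩ := hT.bounds_of_pos hb hab hs
  have hs2 : 0 < s ^ 2 := by positivity
  have hb' (h : s = b) : (s, τ) ∈ criticalArcs a b :=
    .inr (.inr (.inr (.inr (.inr (.inr (.inl ⟨h, b1⟩))))))
  have ha' (h : s = a) : (s, τ) ∈ criticalArcs a b :=
    .inr (.inr (.inr (.inr (.inr (.inr (.inr ⟨h, b1⟩))))))
  rcases hsep with h | h | h | h
  · rw [sigma_eq, mul_eq_zero, sub_eq_zero, sub_eq_zero] at h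
    rcases h with h | h
    · exact .inl ⟨h, .inr hs⟩
    · have h1 : b ≤ s := (sq_le_sq₀ hb.le hs.le).1 (b2 (by nlinarith))
      rcases h1.eq_or_lt with h' | h'
      · exact hb' h'.symm
      · exact .inr (.inl ⟨h, .inr h'⟩)
  · have hθ := theta_eq_abs hτ h
    rw [abs_of_pos hs] at hθ
    have hθ' (h1 : τ ∈ Set.Ioo (-(a ^ 2 - b ^ 2)) 0 ∪ Set.Ioo ((a - b) ^ 2) (a ^ 2 - b ^ 2)) :
        (s, τ) ∈ criticalArcs a b :=
      .inr (.inr (.inr (.inr (.inr (.inl ⟨hθ.symm, h1⟩)))))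
    rcases lt_or_gt_of_ne hτ with hτ' | hτ'
    · rcases lt_or_ge (-(a ^ 2 - b ^ 2)) τ with h1 | h1
      · exact hθ' (.inl ⟨h1, hτ'⟩)
      -- On the curve, −4τ(s² − a²) = (r² + τ)² ≥ 0, against s² ≤ a² for τ ≤ −r²: only the line s =
      -- a is met.
      · apply ha'
        have h3 : 4 * -τ * (s ^ 2 - a ^ 2) = (a ^ 2 - b ^ 2 + τ) ^ 2 := by
          unfold sigma at h
          linear_combination -h
        have h4 : 0 ≤ s ^ 2 - a ^ 2 :=
          nonneg_of_mul_nonneg_right (h3 ▸ sq_nonneg _) (by linarith)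
        exact (sq_eq_sq₀ hs.le ha.le).1 (le_antisymm (b3 h1) (sub_nonneg.1 h4))
    · rcases lt_or_ge τ (a ^ 2 - b ^ 2) with h1 | h1
      · refine hθ' (.inr ⟨?_, h1⟩)
        rw [sigma_eq] at h
        nlinarith [mul_pos hs2 hτ']
      · apply hb'
        have h3 : 4 * τ * (b ^ 2 - s ^ 2) = (a ^ 2 - b ^ 2 - τ) ^ 2 := by
          unfold sigma at h
          linear_combination -h
        have h4 : 0 ≤ b ^ 2 - s ^ 2 :=
          nonneg_of_mul_nonneg_right (h3 ▸ sq_nonneg _) (by linarith)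
        exact (sq_eq_sq₀ hs.le hb.le).1 (le_antisymm (sub_nonneg.1 h4) (b2 h1))
  · exact ha' ((sq_eq_sq₀ hs.le ha.le).1 h)
  · exact hb' ((sq_eq_sq₀ hs.le hb.le).1 h)

lemma diagram_subset (hb : 0 < b) (hab : b < a) {s τ : ℝ} (h : (s, τ) ∈ bifurcationDiagram a b) :
    (τ = 0 ∧ 0 < s) ∨ (s, τ) ∈ criticalArcs a b := by
  obtain ⟨⟨⟨⟨α, β, w⟩, s'⟩, hq, he⟩, hsep⟩ := h
  obtain ⟨h1, h2⟩ : s' = s ∧ integralT (α, β, w) = τ := Prod.mk.inj he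
  subst h1
  rw [completedO_eq hb hab] at hq
  have hs0 : s' ≠ 0 := ne_zero_of_mem hb hab hq
  have hT := tiltedEquations_of_mem hq
  rw [h2] at hT
  rw [mem_separatingSet_iff hb hab] at hsep
  have hsep := hsep.resolve_left hs0
  rcases lt_or_gt_of_ne hs0 with hs | hs
  · have hτ : τ ≠ 0 :=
      ((pow_pos (sub_pos.2 hab) 2).trans_le (hT.bounds_of_neg hb hab hs).1).ne'
    exact .inr (mem_criticalArcs_of_neg hb hab hT hs (hsep.resolve_left hτ))
  · rcases eq_or_ne τ 0 with hτ | hτ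
    · exact .inl ⟨hτ, hs⟩
    · exact .inr (mem_criticalArcs_of_pos hb hab hT hs hτ (hsep.resolve_left hτ))

end

end KowalevskiTop

open KowalevskiTop in
theorem mainTheorem4 (a b : ℝ) (hb : 0 < b) (hab : b < a) :
    bifurcationDiagram a b =
        {f : ℝ × ℝ |
          (f.2 = 0 ∧ f.1 ∈ Set.Ioi 0) ∨
          (f.2 = (a - b) ^ 2 ∧ f.1 ∈ Set.Icc (-a) (-b) ∪ Set.Ioi 0) ∨
          (f.2 = (a + b) ^ 2 ∧ f.1 ∈ Set.Ico (-a) 0 ∪ Set.Ioi b) ∨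
          (f.1 = -a ∧ f.2 ∈ Set.Ici ((a - b) ^ 2)) ∨
          (f.1 = -b ∧ f.2 ∈ Set.Ici ((a - b) ^ 2)) ∨
          (f.1 = -theta a b f.2 ∧ f.2 ∈ Set.Ioo (a ^ 2 - b ^ 2) ((a + b) ^ 2)) ∨
          (f.1 = theta a b f.2 ∧
            f.2 ∈ Set.Ioo (-(a ^ 2 - b ^ 2)) 0 ∪ Set.Ioo ((a - b) ^ 2) (a ^ 2 - b ^ 2)) ∨
          (f.1 = b ∧ f.2 ∈ Set.Iic ((a + b) ^ 2)) ∨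
          (f.1 = a ∧ f.2 ∈ Set.Iic ((a + b) ^ 2))} ∧
      criticalValues a b =
        {f : ℝ × ℝ | f ∈ bifurcationDiagram a b ∧ (f.2 = 0 → f.1 = a ∨ f.1 = b)} := by
  have h1 := criticalArcs_subset hb hab
  have h2 := criticalValues_subset_diagram hb hab
  refine ⟨Set.Subset.antisymm ?_ ?_, Set.Subset.antisymm h2 ?_⟩
  · rintro ⟨s, τ⟩ h
    exact diagram_subset hb hab h
  · rintro ⟨s, τ⟩ (⟨h, hs⟩ | h)
    · obtain rfl : τ = 0 := h
      exact ⟨mem_admissibleSet_zero hb hab hs,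
        (mem_separatingSet_iff hb hab).2 (Or.inr (Or.inl rfl))⟩
    · exact (h2 (h1 h)).1
  · rintro ⟨s, τ⟩ ⟨h, h0⟩
    rcases diagram_subset hb hab h with ⟨rfl, -⟩ | h
    · rcases h0 rfl with h | h <;> obtain rfl := h
      · exact mem_criticalValues_a hb hab (by positivity)
      · exact mem_criticalValues_b hb hab (by positivity)
    · exact h1 h
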